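/- Let $d\ge 1$, $m\ge 0$, let $X$ (in $\mathbb{R}^d$) and $\epsilon_0$ (the random seed, in $\mathbb{R}^m$) be independent random vectors, $g:\mathbb{R}^d\times\mathbb{R}^m\to\mathbb{R}$ measurable, $Y=g(X,\epsilon_0)$ and $Y^z=g(z,\epsilon_0)$. Assume: (A1) for every $z\in\operatorname{supp}(X)$ there is $M(z)$ such that $|F_{Y^B}(t)-F_{Y^z}(t)|\le M(z)\,r$ for all $t\in\mathbb{R}$ and every ball $B$ with centre $z$ and radius $r>0$, where $Y^B$ has the law of $Y$ given $X\in B$; (A2) $X$ has a density, which is bounded below by a positive constant on $\operatorname{supp}(X)$; (A3) $g$ takes its values in a compact interval $[L_Y,U_Y]$; (A4) for every $z\in\operatorname{supp}(X)$ the law of $g(z,\epsilon_0)$ has a density which is bounded below by a constant $C_g(z)>0$ on the support of this law, and this support is an interval. Let $\alpha\in[1/2,1)$ and let $x\in\operatorname{supp}(X)$ be a point where the support has no cusp: there are $c,r_0>0$ with $\lambda(\operatorname{supp}(X)\cap B(x,r))\ge c\,\lambda(B(x,r))$ for $0<r\le r_0$ ($\lambda$ is Lebesgue measure). Let $\theta^*(x)$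 be the $\alpha$-quantile of $g(x,\epsilon_0)$. For an i.i.d. sample $(X_n,Y_n)_{n\ge1}$ of $(X,Y)$ and parameters $\gamma,\beta$, put $k_n=\lfloor n^\beta\rfloor$, let $\theta_0(x)\in\mathbb{R}$ and $$\theta_{n+1}(x)=\theta_n(x)-(n+1)^{-\gamma}\left(\mathbf 1_{Y_{n+1}\le\theta_n(x)}-\alpha\right)\mathbf 1_{\{X_{n+1}\in kNN_{n+1}(x)\}},$$ where $X_{n+1}\in kNN_{n+1}(x)$ means that fewer than $k_{n+1}$ of $X_1,\dots,X_n$ are strictly closer to $x$ than $X_{n+1}$. Let $a_n(x)=\mathbb{E}\big[(\theta_n(x)-\theta^*(x))^2\big]$. Call $(\gamma,\beta,\epsilon)$ admissible if $0<\gamma\le\beta<1$, $1-\beta<\epsilon<1-\gamma$ and, in addition, $\epsilon<(1+\frac1d)(1-\beta)$ when $\beta>1-d\gamma$, and $\epsilon<1-\beta+\gamma$ when $\beta\le1-d\gamma$. Put $r(\gamma,\beta,\epsilon)=(1+\frac1d)(1-\beta)-\epsilon$ when $\beta>1-d\gamma$ and $r(\gamma,\beta,\epsilon)=\gamma-\beta+1-\epsilon$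 when $\beta\le1-d\gamma$. All constants $C,N$ below depend only on the laws of $X$ and $\epsilon_0$, on $g$, $\alpha$, $x$, $d$, the parameters, and an upper bound for $|\theta_0(x)|$. 1. For every admissible $(\gamma,\beta,\epsilon)$ there are $C>0$ and $N$ with $a_n(x)\le C\,n^{-r(\gamma,\beta,\epsilon)}$ for all $n\ge N$. 2. This bound is optimised by $\gamma=\frac1{1+d}$ and $\beta=\gamma+\eta_\beta$ with $\eta_\beta>0$ as small as possible, in the following sense. Every admissible triple has $r(\gamma,\beta,\epsilon)<\frac1{1+d}$, and $\frac1{1+d}$ is the supremum of $r$ over the admissible triples. For $\gamma=\frac1{1+d}$, $\beta=\gamma+\eta_\beta<1$ with $\eta_\beta>0$, the supremum of $r$ over the admissible $\epsilon$ is $\frac1{1+d}-\frac{\eta_\beta}d$. If $r$ tends to $\frac1{1+d}$ along a sequence of admissible triples, then $\gamma\to\frac1{1+d}$ and $\beta\to\frac1{1+d}$ along it. 3. For $\gamma=\frac1{1+d}$ and $\beta=\gamma+\eta_\beta<1$ with $\eta_\beta>0$, and for $1-\beta<\epsilon<1$, $\eta_\epsilon=\epsilon-(1-\beta)$ and $\eta=\frac{\eta_\epsilon}2+\eta_\beta$,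 there are $C_9>0$ and $N_4$ such that $$a_n(x)\le C_9\,n^{-\left(\frac1{1+d}-\eta\right)}\qquad\text{for all } n\ge N_4 .$$ -/

import Mathlib

open MeasureTheory ProbabilityTheory Filter Topology

universe u

noncomputable section

/-- The Euclidean space `ℝ^d`. -/
abbrev Euc (d : ℕ) : Type := EuclideanSpace ℝ (Fin d)

/-! ### The stochastic code

`μ` is the law of the input `X`, `ν` the law of the random seed, the two being independent,
and `Y = g X seed`. -/

/-- The law of `Y^x = g(x, seed)`. -/
def outputLaw {d m : ℕ} (ν : Measure (Euc m)) (g : Euc d → Euc m → ℝ) (x : Euc d) : Measure ℝ :=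
  ν.map (g x)

/-- The law of `Y = g(X, seed)` given that `X` lies in the ball of centre `x` and radius `r`. -/
def localOutputLaw {d m : ℕ} (μ : Measure (Euc d)) (ν : Measure (Euc m))
    (g : Euc d → Euc m → ℝ) (x : Euc d) (r : ℝ) : Measure ℝ :=
  (cond (μ.prod ν) (Prod.fst ⁻¹' Metric.closedBall x r)).map (fun p => g p.1 p.2)

/-- The quantile of level `α` of a law on `ℝ`: the generalized inverse of its distribution
function. -/
def quantile (ρ : Measure ℝ) (α : ℝ) : ℝ := sInf {t : ℝ | α ≤ cdf ρ t}

/-! ### The assumptions on the model -/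

/-- For every `z` in the support of `X` there is `M(z)` such that
`|F_{Y^B}(t) - F_{Y^z}(t)| ≤ M(z) r_B` for all `t` and all balls `B` centred at `z`. -/
def LipschitzConditionalLaws {d m : ℕ} (μ : Measure (Euc d)) (ν : Measure (Euc m))
    (g : Euc d → Euc m → ℝ) : Prop :=
  ∀ z ∈ μ.support, ∃ M : ℝ, ∀ r : ℝ, 0 < r → ∀ t : ℝ,
    |cdf (localOutputLaw μ ν g z r) t - cdf (outputLaw ν g z) t| ≤ M * r

/-- `ρ` has a density with respect to Lebesgue measure, bounded below by a positive constant on the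
support of `ρ`. -/
def HasDensityBoundedBelow {E : Type*} [MeasureSpace E] [TopologicalSpace E]
    (ρ : Measure E) : Prop :=
  ∃ c : ℝ, 0 < c ∧ ∃ f : E → ENNReal, Measurable f ∧ ρ = volume.withDensity f ∧
    ∀ z ∈ ρ.support, ENNReal.ofReal c ≤ f z

/-- The support of `μ` fills a positive proportion of every small ball centred at `x`
(there is no cusp at `x`). -/
def SupportFatAt {d : ℕ} (μ : Measure (Euc d)) (x : Euc d) : Prop :=
  ∃ c : ℝ, 0 < c ∧ ∃ r₀ : ℝ, 0 < r₀ ∧ ∀ r : ℝ, 0 < r → r ≤ r₀ →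
    ENNReal.ofReal c * volume (Metric.closedBall x r) ≤
      volume (μ.support ∩ Metric.closedBall x r)

/-- The code takes its values in a compact interval. -/
def BoundedCode {d m : ℕ} (g : Euc d → Euc m → ℝ) : Prop :=
  ∃ L U : ℝ, ∀ z e, g z e ∈ Set.Icc L U

/-- For every `z` in the support of `X`, the law of `g(z, seed)` has a density that is bounded below
by a positive constant on the support of this law, which is an interval. -/
def OutputDensities {d m : ℕ} (μ : Measure (Euc d)) (ν : Measure (Euc m))
    (g : Euc d → Euc m → ℝ) : Prop :=
  ∀ z ∈ μ.support, HasDensityBoundedBelow (outputLaw ν g z) ∧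
    (outputLaw ν g z).support.OrdConnected

/-! ### The algorithm

Samples are indexed from `0`: `X n`, `Y n` are the `(n+1)`-st observations. -/

/-- `k_n = ⌊n^β⌋`. -/
def numNeighbours (β : ℝ) (n : ℕ) : ℕ := ⌊(n : ℝ) ^ β⌋₊

open Classical in
/-- The `(n+1)`-st point `X n` is one of the `k` nearest neighbours of `x`: fewer than `k` of the
`n` previous points are strictly closer to `x`. -/
def IsNearestNeighbour {d : ℕ} (x : Euc d) (X : ℕ → Euc d) (n k : ℕ) : Prop :=
  ((Finset.range n).filter (fun i => ‖X i - x‖ < ‖X n - x‖)).card < k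

open Classical in
/-- The `k`-th order statistic of `s 0, …, s (n - 1)`, for `1 ≤ k ≤ n`. -/
def orderStat (s : ℕ → ℝ) (k n : ℕ) : ℝ :=
  sInf {v : ℝ | k ≤ ((Finset.range n).filter (fun i => s i ≤ v)).card}

open Classical in
/-- `X n` is a nearest neighbour exactly when its distance to `x` is at most the `k`-th
order statistic of the distances of the previous points. -/
theorem isNearestNeighbour_iff {d : ℕ} (x : Euc d) (X : ℕ → Euc d) (n k : ℕ)
    (hk : 1 ≤ k) (hkn : k ≤ n) :
    IsNearestNeighbour x X n k ↔ ‖X n - x‖ ≤ orderStat (fun i => ‖X i - x‖) k n := by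
  unfold IsNearestNeighbour orderStat
  set s : ℕ → ℝ := fun i => ‖X i - x‖ with hs
  set v := ‖X n - x‖ with hv
  have hsub : ∀ w : ℝ, w < v → (Finset.range n).filter (fun i => s i ≤ w) ⊆
      (Finset.range n).filter (fun i => s i < v) := fun w hw i hi => by
    simp only [Finset.mem_filter] at hi ⊢
    exact ⟨hi.1, hi.2.trans_lt hw⟩
  constructor
  · intro h
    refine le_csInf ⟨∑ i ∈ Finset.range n, s i, ?_⟩ fun w hw => ?_
    · show k ≤ _
      rw [Finset.filter_true_of_mem, Finset.card_range]
      · exact hkn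
      · exact fun i hi => Finset.single_le_sum (f := s) (fun j _ => norm_nonneg _) hi
    · by_contra! hlt
      exact absurd (hw.trans (Finset.card_le_card (hsub w hlt))) (not_le.mpr h)
  · intro h
    by_contra! hle
    have hne : ((Finset.range n).filter (fun i => s i < v)).Nonempty :=
      Finset.card_pos.mp (lt_of_lt_of_le hk hle)
    obtain ⟨j, hj, hmax⟩ := Finset.exists_max_image _ s hne
    have hjv : s j < v := (Finset.mem_filter.mp hj).2
    have hbd : BddBelow {w : ℝ | k ≤ ((Finset.range n).filter (fun i => s i ≤ w)).card} := by
      refine ⟨0, fun w hw => ?_⟩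
      obtain ⟨i, hi⟩ := Finset.card_pos.mp (lt_of_lt_of_le hk hw)
      exact (norm_nonneg _).trans (Finset.mem_filter.mp hi).2
    have hmem : s j ∈ {w : ℝ | k ≤ ((Finset.range n).filter (fun i => s i ≤ w)).card} := by
      refine hle.trans (Finset.card_le_card fun i hi => ?_)
      exact Finset.mem_filter.mpr ⟨(Finset.mem_filter.mp hi).1, hmax i hi⟩
    exact absurd (h.trans (csInf_le hbd hmem)) (not_le.mpr hjv)

open Classical in
/-- The sequential estimator `θ_n(x)`, with steps `γ_n = n^{-γ}` and `k_n = ⌊n^β⌋` neighbours. -/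
def theta {d : ℕ} (α γ β θ₀ : ℝ) (x : Euc d) (X : ℕ → Euc d) (Y : ℕ → ℝ) : ℕ → ℝ
  | 0 => θ₀
  | n + 1 =>
    theta α γ β θ₀ x X Y n - ((n + 1 : ℕ) : ℝ) ^ (-γ) *
      ((if Y n ≤ theta α γ β θ₀ x X Y n then 1 else 0) - α) *
      (if IsNearestNeighbour x X n (numNeighbours β (n + 1)) then 1 else 0)

/-- The pairs `(X n, seed n)` are i.i.d. with law `μ ⊗ ν`. -/
def IsSample {d m : ℕ} {Ω : Type*} [MeasurableSpace Ω] (P : Measure Ω) (μ : Measure (Euc d))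
    (ν : Measure (Euc m)) (X : ℕ → Ω → Euc d) (seed : ℕ → Ω → Euc m) : Prop :=
  (∀ n, HasLaw (fun ω => (X n ω, seed n ω)) (μ.prod ν) P) ∧
    iIndepFun (fun n ω => (X n ω, seed n ω)) P

/-- The squared error `(θ_n(x) - θ^*(x))²`, as a random variable. -/
def sqError {d m : ℕ} {Ω : Type*} (ν : Measure (Euc m)) (g : Euc d → Euc m → ℝ)
    (α γ β θ₀ : ℝ) (x : Euc d) (X : ℕ → Ω → Euc d) (seed : ℕ → Ω → Euc m) (n : ℕ) (ω : Ω) : ℝ :=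
  (theta α γ β θ₀ x (fun i => X i ω) (fun i => g (X i ω) (seed i ω)) n
    - quantile (outputLaw ν g x) α) ^ 2

/-- The mean square error satisfies `a_n(x) ≤ C n^{-r}` for `n ≥ N`. The constants `C` and `N`
depend on the model, on `α`, `x`, `γ`, `β`, `r` and on a bound `R` for the initial value, but
neither on the sample nor on the probability space that carries it. -/
def MSERate {d m : ℕ} (μ : Measure (Euc d)) (ν : Measure (Euc m)) (g : Euc d → Euc m → ℝ)
    (α : ℝ) (x : Euc d) (R γ β r : ℝ) : Prop :=
  ∃ C : ℝ, 0 < C ∧ ∃ N : ℕ,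
    ∀ (Ω : Type u) [MeasurableSpace Ω] (P : Measure Ω) [IsProbabilityMeasure P]
      (X : ℕ → Ω → Euc d) (seed : ℕ → Ω → Euc m), IsSample P μ ν X seed →
      ∀ θ₀ : ℝ, |θ₀| ≤ R → ∀ n : ℕ, N ≤ n →
        Integrable (sqError ν g α γ β θ₀ x X seed n) P ∧
        ∫ ω, sqError ν g α γ β θ₀ x X seed n ω ∂P ≤ C * (n : ℝ) ^ (-r)

/-! ### The upper bound as a function of the parameters -/

/-- The triples `(γ, β, ε)` for which the upper bound on the mean square error is established. -/
def Admissible (d : ℕ) (γ β ε : ℝ) : Prop :=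
  0 < γ ∧ γ ≤ β ∧ β < 1 ∧ 1 - β < ε ∧ ε < 1 - γ ∧
    (1 - d * γ < β → ε < (1 + 1 / (d : ℝ)) * (1 - β)) ∧
    (β ≤ 1 - d * γ → ε < 1 - β + γ)

open Classical in
/-- The exponent `r` of the upper bound `C n^{-r}` on the mean square error. -/
def rateExponent (d : ℕ) (γ β ε : ℝ) : ℝ :=
  if 1 - d * γ < β then (1 + 1 / (d : ℝ)) * (1 - β) - ε else γ - β + 1 - ε

end

/-! ### The exponent of the upper bound -/

/-! Given the first n samples, the neighbour test is membership of the new point in the ball around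
`x` whose radius is the k-th order statistic of the earlier distances. Let p be the mass of this
ball and s the step. Expanding the square, the conditional error after one step is at most (1 -
2csp)(θ_n - θ*)² plus a bias of order s p^(1+1/d) plus a variance s² p (`integral_step_sq_le`). The
contraction comes from the linear growth of the distribution function at the quantile
(`exists_quadratic_lower_bound`). The bias comes from the Lipschitz assumption, since a small ball
of mass p has radius O(p^(1/d)) (`exists_cdf_sub_le_rpow`).

With N = n + 1, Chernoff bounds place p between N^(-ε) and 8 N^(β-1), outside an event whose
probability decays faster than every power. Hence a_{n+1} ≤ (1 - 2c N^(-γ-ε)) a_n + D N^(-γ-ε-r)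
(`integral_seqSqError_succ_le`), where r is the smaller of the exponents (1+1/d)(1-β) - ε of the
bias and γ + 1 - β - ε of the variance, both relative to the contraction. As γ + ε < 1, this gives
a_n = O(n^(-r)) (`exists_rate_of_contraction`).

For the optimisation, ε > 1 - β forces r < γ and d r < 1 - β. With γ ≤ β this reads (1+d) r < 1, and
γ, β are squeezed between r and 1 - d r. -/

theorem Admissible.rateExponent_lt {d : ℕ} (hd : 1 ≤ d) {γ β ε : ℝ} (h : Admissible d γ β ε) :
    rateExponent d γ β ε < γ ∧ β < 1 - d * rateExponent d γ β ε := by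
  obtain ⟨h0, h1, h2, h3, h4, h5, h6⟩ := h
  have hd' : (1 : ℝ) ≤ d := by exact_mod_cast hd
  have hd0 : (0 : ℝ) < d := by linarith
  unfold rateExponent
  split_ifs with hc
  · have e1 : (1 + 1 / (d : ℝ)) * (1 - β) - ε = (1 - β) / d - (ε - (1 - β)) := by ring
    have e2 : d * ((1 - β) / d) = 1 - β := by field_simp
    have e3 : (1 - β) / d < γ := by rw [div_lt_iff₀ hd0]; linarith
    rw [e1]
    refine ⟨by linarith, ?_⟩
    rw [mul_sub, e2]
    nlinarith
  · refine ⟨by linarith, ?_⟩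
    nlinarith

theorem Admissible.rateExponent_pos {d : ℕ} {γ β ε : ℝ} (h : Admissible d γ β ε) :
    0 < rateExponent d γ β ε := by
  obtain ⟨h0, h1, h2, h3, h4, h5, h6⟩ := h
  unfold rateExponent
  split_ifs with hc
  · linarith [h5 hc]
  · linarith [h6 (not_lt.1 hc)]

/-- The case distinction is exactly the comparison of (1 - β)/d with γ, so `rateExponent` is the
minimum of the bias and variance exponents; the recursion needs only these two bounds. -/
theorem rateExponent_le {d : ℕ} (hd : 1 ≤ d) {γ β ε : ℝ} :
    rateExponent d γ β ε ≤ γ + 1 - β - ε ∧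
      rateExponent d γ β ε ≤ (1 + 1 / (d : ℝ)) * (1 - β) - ε := by
  have hd0 : (0 : ℝ) < d := by exact_mod_cast hd
  have e1 : (1 + 1 / (d : ℝ)) * (1 - β) - ε = (1 - β) / d + (1 - β) - ε := by ring
  unfold rateExponent
  split_ifs with hc
  · have e3 : (1 - β) / d < γ := by rw [div_lt_iff₀ hd0]; linarith
    exact ⟨by linarith, le_rfl⟩
  · have e3 : γ ≤ (1 - β) / d := by rw [le_div_iff₀ hd0]; linarith
    exact ⟨by linarith, by linarith⟩

theorem Admissible.rateExponent_lt_sup {d : ℕ} (hd : 1 ≤ d) {γ β ε : ℝ}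
    (h : Admissible d γ β ε) : rateExponent d γ β ε < 1 / (1 + (d : ℝ)) := by
  obtain ⟨h1, h2⟩ := h.rateExponent_lt hd
  have hd0 : (0 : ℝ) < d := by exact_mod_cast hd
  rw [lt_div_iff₀ (by linarith)]
  linarith [h.2.1]

/-- The optimal γ is where the line β = 1 - dγ meets β = γ. -/
theorem one_sub_mul_inv {d : ℕ} : 1 - (d : ℝ) * (1 / (1 + (d : ℝ))) = 1 / (1 + (d : ℝ)) := by
  field_simp
  ring

/-- With ε = 1 - β + δ, the remaining constraints are δ < `ηβ` (from ε < 1 - γ) and δ < (1 - β)/d; a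
positive `ηβ` excludes the regime β ≤ 1 - dγ. -/
theorem admissible_optimal {d : ℕ} (hd : 1 ≤ d) {ηβ : ℝ} (h0 : 0 < ηβ)
    (h1 : 1 / (1 + (d : ℝ)) + ηβ < 1) {τ : ℝ} (hτ : 0 < τ) :
    ∃ δ : ℝ, 0 < δ ∧ δ < τ ∧
      Admissible d (1 / (1 + (d : ℝ))) (1 / (1 + (d : ℝ)) + ηβ)
        (1 - (1 / (1 + (d : ℝ)) + ηβ) + δ) := by
  have hd0 : (0 : ℝ) < d := by exact_mod_cast hd
  set b := 1 / (1 + (d : ℝ)) + ηβ with hb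
  have hpos : 0 < (1 - b) / d := by apply div_pos <;> linarith
  obtain ⟨δ, hδ, hδ'⟩ := exists_between (lt_min hτ (lt_min h0 hpos))
  rw [lt_min_iff, lt_min_iff] at hδ'
  have e1 : (1 + 1 / (d : ℝ)) * (1 - b) = (1 - b) / d + (1 - b) := by ring
  have hg : 0 < 1 / (1 + (d : ℝ)) := by positivity
  refine ⟨δ, hδ, hδ'.1, hg, by linarith, h1, by linarith, by linarith, fun _ => by linarith,
    fun h => ?_⟩
  rw [one_sub_mul_inv] at h
  linarith

theorem rateExponent_optimal {d : ℕ} {ηβ : ℝ} (h0 : 0 < ηβ) (ε : ℝ) (hd : 1 ≤ d) :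
    rateExponent d (1 / (1 + (d : ℝ))) (1 / (1 + (d : ℝ)) + ηβ) ε
      = 1 / (1 + (d : ℝ)) - ηβ / d - (ε - (1 - (1 / (1 + (d : ℝ)) + ηβ))) := by
  have hd0 : (0 : ℝ) < d := by exact_mod_cast hd
  unfold rateExponent
  rw [if_pos (by rw [one_sub_mul_inv]; linarith)]
  field_simp
  ring

theorem isLUB_rateExponent_optimal {d : ℕ} (hd : 1 ≤ d) {ηβ : ℝ} (h0 : 0 < ηβ)
    (h1 : 1 / (1 + (d : ℝ)) + ηβ < 1) :
    IsLUB {r : ℝ | ∃ ε : ℝ, Admissible d (1 / (1 + (d : ℝ))) (1 / (1 + (d : ℝ)) + ηβ) ε ∧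
        r = rateExponent d (1 / (1 + (d : ℝ))) (1 / (1 + (d : ℝ)) + ηβ) ε}
        (1 / (1 + (d : ℝ)) - ηβ / d) := by
  constructor
  · rintro r ⟨ε, h, rfl⟩
    rw [rateExponent_optimal h0 ε hd]
    linarith [h.2.2.2.1]
  · intro b hb
    refine le_of_forall_pos_le_add fun τ hτ => ?_
    obtain ⟨δ, hδ, hδτ, hA⟩ := admissible_optimal hd h0 h1 hτ
    have := hb ⟨_, hA, rfl⟩
    rw [rateExponent_optimal h0 _ hd] at this
    linarith

theorem isLUB_rateExponent {d : ℕ} (hd : 1 ≤ d) :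
    IsLUB {r : ℝ | ∃ γ β ε : ℝ, Admissible d γ β ε ∧ r = rateExponent d γ β ε}
      (1 / (1 + (d : ℝ))) := by
  have hd1 : (1 : ℝ) ≤ d := by exact_mod_cast hd
  constructor
  · rintro r ⟨γ, β, ε, h, rfl⟩
    exact (h.rateExponent_lt_sup hd).le
  · intro b hb
    refine le_of_forall_pos_le_add fun τ hτ => ?_
    have hlt : 1 / (1 + (d : ℝ)) < 1 := by rw [div_lt_one (by linarith)]; linarith
    obtain ⟨ηβ, h0, h1⟩ := exists_between (lt_min hτ (sub_pos.2 hlt))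
    rw [lt_min_iff] at h1
    have h2 : 1 / (1 + (d : ℝ)) + ηβ < 1 := by linarith
    have := (isLUB_rateExponent_optimal hd h0 h2).2
      (show b ∈ upperBounds _ by rintro r ⟨ε, h, rfl⟩; exact hb ⟨_, _, ε, h, rfl⟩)
    have h3 : ηβ / d ≤ ηβ := div_le_self h0.le hd1
    linarith

/-- Squeeze in r < γ ≤ β < 1 - d r: both ends have limit 1/(1+d). -/
theorem tendsto_of_rateExponent_tendsto {d : ℕ} (hd : 1 ≤ d) {γ β ε : ℕ → ℝ}
    (hA : ∀ j, Admissible d (γ j) (β j) (ε j))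
    (hr : Tendsto (fun j => rateExponent d (γ j) (β j) (ε j)) atTop (𝓝 (1 / (1 + (d : ℝ))))) :
    Tendsto γ atTop (𝓝 (1 / (1 + (d : ℝ)))) ∧ Tendsto β atTop (𝓝 (1 / (1 + (d : ℝ)))) := by
  have hu : Tendsto (fun j => 1 - d * rateExponent d (γ j) (β j) (ε j)) atTop
      (𝓝 (1 / (1 + (d : ℝ)))) := by
    have := (hr.const_mul (d : ℝ)).const_sub 1
    rwa [one_sub_mul_inv] at this
  have hb := fun j => (hA j).rateExponent_lt hd
  exact ⟨tendsto_of_tendsto_of_tendsto_of_le_of_le hr hu (fun j => (hb j).1.le)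
      fun j => ((hA j).2.1.trans (hb j).2.le),
    tendsto_of_tendsto_of_tendsto_of_le_of_le hr hu (fun j => ((hb j).1.le.trans (hA j).2.1))
      fun j => (hb j).2.le⟩

/-! ### A recursive inequality -/

/-- Bernoulli's inequality for (n/(n+1))^r. It needs an exponent at least 1, and raising r to `max r
1` only lowers a power with base below 1. -/
theorem rpow_neg_succ_ge (r : ℝ) {n : ℕ} (hn : 1 ≤ n) :
    (n : ℝ) ^ (-r) * (1 - max r 1 / (n + 1)) ≤ ((n + 1 : ℕ) : ℝ) ^ (-r) := by
  have hn0 : (0 : ℝ) < n := by exact_mod_cast hn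
  have e : ((n + 1 : ℕ) : ℝ) ^ (-r) = (n : ℝ) ^ (-r) * (1 + -(1 / ((n : ℝ) + 1))) ^ r := by
    have : 1 + -(1 / ((n : ℝ) + 1)) = n / (n + 1) := by field_simp; ring
    rw [this, Real.div_rpow hn0.le (by positivity), Real.rpow_neg hn0.le,
      Real.rpow_neg (by positivity)]
    have := (Real.rpow_pos_of_pos hn0 r).ne'
    push_cast
    field_simp
  have hle : 1 / ((n : ℝ) + 1) ≤ 1 := by rw [div_le_one (by positivity)]; linarith
  rw [e]
  refine mul_le_mul_of_nonneg_left ?_ (by positivity)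
  have h1 := one_add_mul_self_le_rpow_one_add (s := -(1 / ((n : ℝ) + 1))) (by linarith)
    (le_max_right r 1)
  have hp : 0 < 1 / ((n : ℝ) + 1) := by positivity
  have hlt : 0 < 1 + -(1 / ((n : ℝ) + 1)) := by
    have : 1 / ((n : ℝ) + 1) < 1 := by rw [div_lt_one (by positivity)]; linarith
    linarith
  calc 1 - max r 1 / (n + 1) = 1 + max r 1 * -(1 / ((n : ℝ) + 1)) := by ring
    _ ≤ _ := h1
    _ ≤ _ := Real.rpow_le_rpow_of_exponent_ge hlt (by linarith) (le_max_left r 1)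

/-- A bounded sequence with `u (n + 1) ≤ (1 - c (n + 1)^{-a}) u n + D (n + 1)^{-a-r}`, `a < 1`, is
`O(n^{-r})`. -/
theorem exists_rate_of_contraction {a r c D A : ℝ} (ha1 : a < 1) (ha : 0 < a) (hr : 0 ≤ r)
    (hc : 0 < c) (hD : 0 ≤ D) (N₀ : ℕ) :
    ∃ C : ℝ, 0 < C ∧ ∃ N : ℕ, ∀ u : ℕ → ℝ, (∀ n, 0 ≤ u n) → (∀ n, u n ≤ A) →
      (∀ n, N₀ ≤ n → u (n + 1) ≤ (1 - c * ((n + 1 : ℕ) : ℝ) ^ (-a)) * u n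
        + D * ((n + 1 : ℕ) : ℝ) ^ (-(a + r))) →
      ∀ n, N ≤ n → u n ≤ C * (n : ℝ) ^ (-r) := by
  have hcast : Tendsto (fun n : ℕ => ((n + 1 : ℕ) : ℝ)) atTop atTop :=
    tendsto_natCast_atTop_atTop.comp (tendsto_add_atTop_nat 1)
  -- Half of the contraction must pay for replacing n^(-r) by (n+1)^(-r), a relative loss of order
  -- 1/n; this is possible because a < 1.
  have h1 : ∀ᶠ n : ℕ in atTop, max r 1 / (c / 2) ≤ ((n + 1 : ℕ) : ℝ) ^ (1 - a) :=
    ((tendsto_rpow_atTop (by linarith)).comp hcast).eventually_ge_atTop _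
  have h2 : ∀ᶠ n : ℕ in atTop, c ≤ ((n + 1 : ℕ) : ℝ) ^ a :=
    ((tendsto_rpow_atTop ha).comp hcast).eventually_ge_atTop _
  obtain ⟨N, hN⟩ := eventually_atTop.1 (h1.and (h2.and (eventually_ge_atTop (max N₀ 1))))
  have hN1 : 1 ≤ N := (le_max_right _ _).trans (hN N le_rfl).2.2
  have hNpos : (0 : ℝ) < N := by exact_mod_cast hN1
  -- The first term lets the other half of the contraction absorb `D`, the second starts the
  -- induction at `N`. Neither depends on `u`, so the rate is uniform over samples and initial
  -- values.
  set C := max (2 * D / c) (|A| * (N : ℝ) ^ r) + 1 with hC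
  have hC1 : 2 * D / c ≤ C := (le_max_left _ _).trans (by linarith)
  have hC2 : |A| * (N : ℝ) ^ r ≤ C := (le_max_right _ _).trans (by linarith)
  have hCpos : 0 < C := by
    have : 0 ≤ 2 * D / c := by positivity
    have := le_max_left (2 * D / c) (|A| * (N : ℝ) ^ r)
    linarith
  refine ⟨C, hCpos, N, fun u hu0 huA hrec n hn => ?_⟩
  induction n, hn using Nat.le_induction with
  | base =>
    rw [Real.rpow_neg hNpos.le, ← div_eq_mul_inv, le_div_iff₀ (by positivity)]
    refine le_trans ?_ hC2
    exact mul_le_mul_of_nonneg_right ((huA N).trans (le_abs_self A)) (by positivity)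
  | succ n hn ih =>
    obtain ⟨g1, g2, g3⟩ := hN n hn
    have hn1 : 1 ≤ n := (le_max_right _ _).trans g3
    have hn0 : (0 : ℝ) < n := by exact_mod_cast hn1
    have hs : (0 : ℝ) < ((n + 1 : ℕ) : ℝ) := by positivity
    have hle := hrec n ((le_max_left _ _).trans g3)
    have hb := rpow_neg_succ_ge r hn1
    set y := ((n + 1 : ℕ) : ℝ) ^ (-a) with hy
    have hy0 : 0 < y := Real.rpow_pos_of_pos hs _
    have hcy : 0 ≤ 1 - c * y := by
      rw [hy, Real.rpow_neg hs.le, sub_nonneg, ← div_eq_mul_inv]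
      exact (div_le_one (by positivity)).2 g2
    have hmx : max r 1 / ((n : ℝ) + 1) ≤ c / 2 * y := by
      have e : y = ((n + 1 : ℕ) : ℝ) ^ (1 - a) / ((n : ℝ) + 1) := by
        rw [hy, sub_eq_add_neg, Real.rpow_add hs, Real.rpow_one]
        push_cast
        field_simp
      rw [e, ← mul_div_assoc]
      refine div_le_div_of_nonneg_right ?_ (by positivity)
      rwa [div_le_iff₀' (by positivity)] at g1
    have e2 : ((n + 1 : ℕ) : ℝ) ^ (-(a + r)) ≤ y * (n : ℝ) ^ (-r) := by
      rw [neg_add, Real.rpow_add hs]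
      refine mul_le_mul_of_nonneg_left ?_ hy0.le
      exact Real.rpow_le_rpow_of_nonpos hn0 (by push_cast; linarith) (by linarith)
    set z := (n : ℝ) ^ (-r) with hz
    have hz0 : 0 < z := Real.rpow_pos_of_pos hn0 _
    have hDC : D ≤ c / 2 * C := by
      rw [div_le_iff₀ hc] at hC1
      linarith
    calc u (n + 1) ≤ (1 - c * y) * u n + D * ((n + 1 : ℕ) : ℝ) ^ (-(a + r)) := hle
      _ ≤ (1 - c * y) * (C * z) + (c / 2 * C) * (y * z) := by gcongr
      _ = C * (z * (1 - c / 2 * y)) := by ring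
      _ ≤ C * (z * (1 - max r 1 / (n + 1))) := by gcongr
      _ ≤ C * ((n + 1 : ℕ) : ℝ) ^ (-r) := by gcongr

/-! ### Laws with a density bounded below -/

theorem HasDensityBoundedBelow.absolutelyContinuous {E : Type*} [MeasureSpace E]
    [TopologicalSpace E] {ρ : Measure E} (h : HasDensityBoundedBelow ρ) : ρ ≪ volume := by
  obtain ⟨c, _, f, _, rfl, _⟩ := h
  exact withDensity_absolutelyContinuous _ _

theorem HasDensityBoundedBelow.exists_mul_volume_le {E : Type*} [MeasureSpace E]
    [TopologicalSpace E] {ρ : Measure E} (h : HasDensityBoundedBelow ρ) :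
    ∃ c : ℝ, 0 < c ∧ ∀ s : Set E, MeasurableSet s → s ⊆ ρ.support →
      ENNReal.ofReal c * volume s ≤ ρ s := by
  obtain ⟨c, hc, f, hf, h1, h2⟩ := h
  refine ⟨c, hc, fun s hs hsub => ?_⟩
  calc ENNReal.ofReal c * volume s = ∫⁻ _ in s, ENNReal.ofReal c ∂volume := by simp
    _ ≤ ∫⁻ z in s, f z ∂volume := setLIntegral_mono hf fun z hz => h2 z (hsub hz)
    _ = ρ s := by
      conv_rhs => rw [h1]
      rw [withDensity_apply f hs]

/-- The jumps of a distribution function are its atoms. -/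
theorem continuous_cdf (ρ : Measure ℝ) [IsProbabilityMeasure ρ] [NullSingletonClass ρ] :
    Continuous (cdf ρ) := by
  refine continuous_iff_continuousAt.2 fun t => ?_
  rw [(monotone_cdf ρ).continuousAt_iff_leftLim_eq_rightLim, StieltjesFunction.rightLim_eq]
  have h := StieltjesFunction.measure_singleton (cdf ρ) t
  rw [measure_cdf, measure_singleton] at h
  have h' := ENNReal.ofReal_eq_zero.1 h.symm
  exact le_antisymm ((monotone_cdf ρ).leftLim_le le_rfl) (by linarith)

theorem cdf_sub_cdf (ρ : Measure ℝ) [IsProbabilityMeasure ρ] {s t : ℝ} (h : s ≤ t) :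
    cdf ρ t - cdf ρ s = ρ.real (Set.Ioc s t) := by
  rw [cdf_eq_real, cdf_eq_real, ← Set.Iic_sdiff_Iic,
    measureReal_sdiff (Set.Iic_subset_Iic.2 h) measurableSet_Iic]

theorem cdf_quantile (ρ : Measure ℝ) [IsProbabilityMeasure ρ] [NullSingletonClass ρ] {α : ℝ}
    (h0 : 0 < α) (h1 : α < 1) : cdf ρ (quantile ρ α) = α := by
  have hcont := continuous_cdf ρ
  have hne : {t : ℝ | α ≤ cdf ρ t}.Nonempty :=
    (((tendsto_cdf_atTop ρ).eventually (lt_mem_nhds h1)).exists).imp fun _ h => le_of_lt h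
  have hbdd : BddBelow {t : ℝ | α ≤ cdf ρ t} := by
    obtain ⟨b, hb⟩ := ((tendsto_cdf_atBot ρ).eventually (gt_mem_nhds h0)).exists
    exact ⟨b, fun t ht => le_of_not_gt fun hlt => absurd (monotone_cdf ρ hlt.le)
      (not_le.2 (lt_of_lt_of_le hb ht))⟩
  have hclosed : IsClosed {t : ℝ | α ≤ cdf ρ t} := isClosed_le continuous_const hcont
  refine le_antisymm ?_ (hclosed.csInf_mem hne hbdd)
  refine le_of_tendsto (hcont.tendsto (quantile ρ α) |>.mono_left nhdsWithin_le_nhds :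
    Tendsto _ (𝓝[<] (quantile ρ α)) _) ?_
  filter_upwards [self_mem_nhdsWithin] with t ht
  exact le_of_not_gt fun h => absurd (csInf_le hbdd (show α ≤ cdf ρ t from h.le)) (not_le.2 ht)

theorem quantile_mem_Icc (ρ : Measure ℝ) [IsProbabilityMeasure ρ] [NullSingletonClass ρ] {α : ℝ}
    (h0 : 0 < α) (h1 : α < 1) {L U : ℝ} (h : ∀ᵐ t ∂ρ, t ∈ Set.Icc L U) :
    quantile ρ α ∈ Set.Icc L U := by
  have hq := cdf_quantile ρ h0 h1
  constructor
  · by_contra! hlt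
    have : ρ.real (Set.Iic (quantile ρ α)) = 0 := by
      rw [measureReal_eq_zero_iff]
      refine measure_mono_null (fun t ht => ?_) (ae_iff.1 h)
      exact fun h' => absurd (h'.1.trans ht) (not_le.2 hlt)
    rw [cdf_eq_real, this] at hq
    linarith
  · refine csInf_le ?_ ?_
    · obtain ⟨b, hb⟩ := ((tendsto_cdf_atBot ρ).eventually (gt_mem_nhds h0)).exists
      exact ⟨b, fun t ht => le_of_not_gt fun hlt => absurd (monotone_cdf ρ hlt.le)
        (not_le.2 (lt_of_lt_of_le hb ht))⟩
    · have : ρ.real (Set.Iic U) = 1 := by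
        have hU : Set.Iic U ∈ ae ρ := by filter_upwards [h] with t ht using ht.2
        rw [measureReal_def, (mem_ae_iff_prob_eq_one measurableSet_Iic).1 hU, ENNReal.toReal_one]
      show α ≤ cdf ρ U
      rw [cdf_eq_real, this]
      exact h1.le

/-- The distribution function grows at least linearly around the quantile. -/
theorem exists_quadratic_lower_bound {ρ : Measure ℝ} [IsProbabilityMeasure ρ]
    (hρ : HasDensityBoundedBelow ρ) (hconn : ρ.support.OrdConnected) {α : ℝ} (h0 : 0 < α)
    (h1 : α < 1) (K : ℝ) :
    ∃ c : ℝ, 0 < c ∧ ∀ t : ℝ, |t - quantile ρ α| ≤ K →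
      c * (t - quantile ρ α) ^ 2 ≤ (t - quantile ρ α) * (cdf ρ t - α) := by
  have hac := hρ.absolutelyContinuous
  have : NullSingletonClass ρ := ⟨fun t => hac (measure_singleton t)⟩
  have hq := cdf_quantile ρ h0 h1
  set q := quantile ρ α with hqdef
  obtain ⟨c, hc, hcv⟩ := hρ.exists_mul_volume_le
  have hpos : ∀ s : Set ℝ, ρ.real s ≠ 0 → (s ∩ ρ.support).Nonempty := fun s hs => by
    refine Measure.nonempty_inter_support_of_pos (pos_iff_ne_zero.2 fun h => hs ?_)
    simp [measureReal_def, h]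
  have hIoi : ∀ t, ρ.real (Set.Ioi t) = 1 - cdf ρ t := fun t => by
    rw [cdf_eq_real, ← Set.compl_Iic, probReal_compl_eq_one_sub measurableSet_Iic]
  -- There is mass at or below `s` and above `t`, so ]s, t] lies between two points of the support;
  -- the support being an interval, the density bound holds on it.
  have key : ∀ s t : ℝ, s ≤ t → cdf ρ s ≠ 0 → cdf ρ t ≠ 1 → c * (t - s) ≤ cdf ρ t - cdf ρ s := by
    intro s t hst hs ht
    obtain ⟨a, ha, ha'⟩ := hpos (Set.Iic s) (by rwa [← cdf_eq_real])
    obtain ⟨b, hb, hb'⟩ := hpos (Set.Ioi t) (by rw [hIoi]; exact fun h => ht (by linarith))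
    have hsub : Set.Ioc s t ⊆ ρ.support := fun y hy =>
      hconn.out ha' hb' ⟨le_trans ha hy.1.le, le_trans hy.2 (le_of_lt hb)⟩
    have := hcv _ measurableSet_Ioc hsub
    rw [Real.volume_Ioc, ← ENNReal.ofReal_mul hc.le] at this
    rw [cdf_sub_cdf ρ hst]
    exact (ENNReal.ofReal_le_iff_le_toReal (measure_ne_top _ _)).1 this
  set K' := |K| + 1 with hK'
  have hK'0 : 0 < K' := by positivity
  -- Where the distribution function has saturated at 0 or 1, its distance to α is α or 1 - α, which
  -- dominates c'|t - q| as long as |t - q| ≤ `K'`.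
  set c' := min c (min (α / K') ((1 - α) / K')) with hc'
  have hαK : c' * K' ≤ α := by
    rw [← le_div_iff₀ hK'0]; exact (min_le_right _ _).trans (min_le_left _ _)
  have hαK' : c' * K' ≤ 1 - α := by
    rw [← le_div_iff₀ hK'0]; exact (min_le_right _ _).trans (min_le_right _ _)
  have hc'c : c' ≤ c := min_le_left _ _
  have hc'0 : 0 < c' := by
    refine lt_min hc (lt_min (by positivity) (div_pos (by linarith) hK'0))
  refine ⟨c', hc'0, fun t ht => ?_⟩
  have htK : |t - q| ≤ K' := ht.trans ((le_abs_self K).trans (by linarith))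
  obtain ⟨htl, htu⟩ := abs_le.1 htK
  rcases le_total q t with hqt | hqt
  · have : c' * (t - q) ≤ cdf ρ t - α := by
      by_cases h : cdf ρ t = 1
      · rw [h]
        exact (mul_le_mul_of_nonneg_left htu hc'0.le).trans hαK'
      · have := key q t hqt (by rw [hq]; exact h0.ne') h
        rw [hq] at this
        exact (mul_le_mul_of_nonneg_right hc'c (by linarith)).trans this
    nlinarith
  · have : c' * (q - t) ≤ α - cdf ρ t := by
      by_cases h : cdf ρ t = 0
      · rw [h, sub_zero]
        exact (mul_le_mul_of_nonneg_left (by linarith) hc'0.le).trans hαK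
      · have := key t q hqt h (by rw [hq]; exact h1.ne)
        rw [hq] at this
        exact (mul_le_mul_of_nonneg_right hc'c (by linarith)).trans this
    nlinarith

/-! ### The law of the input around `x` -/

/-- Spheres are null, including the one of radius zero because d ≥ 1, so indicators of balls
converge almost everywhere. -/
theorem continuous_measureReal_closedBall {d : ℕ} (hd : 1 ≤ d) {μ : Measure (Euc d)}
    [IsFiniteMeasure μ] (hμ : μ ≪ volume) (x : Euc d) :
    Continuous fun r => μ.real (Metric.closedBall x r) := by
  have : Nonempty (Fin d) := ⟨⟨0, hd⟩⟩
  have : Nontrivial (Euc d) := inferInstance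
  rw [continuous_iff_continuousAt]
  intro r
  have hind : ∀ s, μ.real (Metric.closedBall x s)
      = ∫ z, (Metric.closedBall x s).indicator (fun _ => (1 : ℝ)) z ∂μ := fun s => by
    rw [integral_indicator Metric.isClosed_closedBall.measurableSet]
    simp
  simp_rw [ContinuousAt, hind]
  refine tendsto_integral_filter_of_dominated_convergence (fun _ => 1) ?_ ?_ (integrable_const _) ?_
  · exact Eventually.of_forall fun s =>
      ((measurable_const.indicator Metric.isClosed_closedBall.measurableSet)).aestronglyMeasurable
  · refine Eventually.of_forall fun s => Eventually.of_forall fun z => ?_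
    by_cases hz : z ∈ Metric.closedBall x s <;> simp [hz]
  · have hs : ∀ᵐ z ∂μ, z ∉ Metric.sphere x r :=
      measure_eq_zero_iff_ae_notMem.1 (hμ (Measure.addHaar_sphere volume x r))
    filter_upwards [hs] with z hz
    rw [Metric.mem_sphere] at hz
    refine tendsto_const_nhds.congr' ?_
    rcases lt_or_gt_of_ne hz with h | h
    · filter_upwards [lt_mem_nhds h] with s hs
      simp [Set.indicator, Metric.mem_closedBall, hs.le, h.le]
    · filter_upwards [gt_mem_nhds h] with s hs
      simp [Set.indicator, Metric.mem_closedBall, not_le.2 hs, not_le.2 h]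

theorem exists_closedBall_measureReal_eq {d : ℕ} (hd : 1 ≤ d) {μ : Measure (Euc d)}
    [IsProbabilityMeasure μ] (hμ : μ ≪ volume) (x : Euc d) {δ : ℝ} (h0 : 0 < δ) (h1 : δ < 1) :
    ∃ r : ℝ, μ.real (Metric.closedBall x r) = δ := by
  have hcont := continuous_measureReal_closedBall hd hμ x
  have htop : Tendsto (fun n : ℕ => μ.real (Metric.closedBall x n)) atTop (𝓝 1) := by
    have hm : Monotone fun n : ℕ => Metric.closedBall x (n : ℝ) := fun a b h =>
      Metric.closedBall_subset_closedBall (by exact_mod_cast h)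
    have := tendsto_measure_iUnion_atTop (μ := μ) hm
    rw [Metric.iUnion_closedBall_nat, measure_univ] at this
    exact (ENNReal.tendsto_toReal ENNReal.one_ne_top).comp this
  obtain ⟨n, hn⟩ := (htop.eventually (lt_mem_nhds h1)).exists
  -- A negative radius gives the empty ball, hence a starting value for the intermediate value
  -- theorem.
  have hneg : μ.real (Metric.closedBall x (-1)) = 0 := by
    rw [Metric.closedBall_eq_empty.2 (by norm_num)]; simp
  have := intermediate_value_Icc (show (-1 : ℝ) ≤ n by linarith [n.cast_nonneg (α := ℝ)])
    hcont.continuousOn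
  obtain ⟨r, -, hr⟩ := this (show δ ∈ Set.Icc _ _ from ⟨by rw [hneg]; exact h0.le, hn.le⟩)
  exact ⟨r, hr⟩

theorem exists_pow_le_measureReal_closedBall {d : ℕ} {μ : Measure (Euc d)}
    [IsProbabilityMeasure μ] (hμ : HasDensityBoundedBelow μ) {x : Euc d} (hfat : SupportFatAt μ x) :
    ∃ c : ℝ, 0 < c ∧ ∃ r₀ : ℝ, 0 < r₀ ∧ ∀ r : ℝ, 0 < r → r ≤ r₀ →
      c * r ^ d ≤ μ.real (Metric.closedBall x r) := by
  obtain ⟨a, ha, hav⟩ := hμ.exists_mul_volume_le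
  obtain ⟨b, hb, r₀, hr₀, hbv⟩ := hfat
  set v := (volume : Measure (Euc d)).real (Metric.closedBall 0 1) with hv
  have hv0 : 0 < v := ENNReal.toReal_pos
    (Metric.measure_closedBall_pos volume _ one_pos).ne' measure_closedBall_lt_top.ne
  refine ⟨a * b * v, by positivity, r₀, hr₀, fun r hr hr' => ?_⟩
  have hm : MeasurableSet (μ.support ∩ Metric.closedBall x r) :=
    (Measure.isClosed_support.inter Metric.isClosed_closedBall).measurableSet
  have h1 : ENNReal.ofReal a * (ENNReal.ofReal b * volume (Metric.closedBall x r))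
      ≤ μ (Metric.closedBall x r) :=
    (mul_le_mul_right (hbv r hr hr') _).trans
      ((hav _ hm Set.inter_subset_left).trans (measure_mono Set.inter_subset_right))
  have h2 : volume (Metric.closedBall x r) = ENNReal.ofReal (r ^ d * v) := by
    have := Measure.addHaar_real_closedBall' (volume : Measure (Euc d)) x hr.le
    rw [finrank_euclideanSpace_fin] at this
    rw [← this, ofReal_measureReal measure_closedBall_lt_top.ne]
  rw [h2, ← ENNReal.ofReal_mul hb.le, ← ENNReal.ofReal_mul ha.le] at h1
  have := (ENNReal.ofReal_le_iff_le_toReal (measure_ne_top _ _)).1 h1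
  calc a * b * v * r ^ d = a * (b * (r ^ d * v)) := by ring
    _ ≤ _ := this

/-- The bias is expressed through the mass of the ball, the quantity that concentrates. Near `x` the
mass is at least c r^d; beyond `r₀` the trivial bound 1 suffices, as the mass is then at least that
of the ball of radius `r₀`. -/
theorem exists_cdf_sub_le_rpow {d m : ℕ} (hd : 1 ≤ d) {μ : Measure (Euc d)}
    [IsProbabilityMeasure μ] {ν : Measure (Euc m)} {g : Euc d → Euc m → ℝ}
    (hA1 : LipschitzConditionalLaws μ ν g) (hA2 : HasDensityBoundedBelow μ) {x : Euc d}
    (hx : x ∈ μ.support) (hfat : SupportFatAt μ x) :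
    ∃ C : ℝ, 0 ≤ C ∧ ∀ r : ℝ, 0 < r → ∀ t : ℝ,
      |cdf (localOutputLaw μ ν g x r) t - cdf (outputLaw ν g x) t|
        ≤ C * μ.real (Metric.closedBall x r) ^ (1 / (d : ℝ)) := by
  obtain ⟨M, hM⟩ := hA1 x hx
  obtain ⟨c, hc, r₀, hr₀, hpow⟩ := exists_pow_le_measureReal_closedBall hA2 hfat
  have hd0 : (d : ℝ) ≠ 0 := by
    have : (0 : ℝ) < d := by exact_mod_cast hd
    exact this.ne'
  have hM0 : 0 ≤ M := by
    have := (abs_nonneg _).trans (hM 1 one_pos 0)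
    linarith
  set b := c ^ (1 / (d : ℝ)) with hb
  have hb0 : 0 < b := Real.rpow_pos_of_pos hc _
  have hroot : ∀ r : ℝ, 0 < r → r ≤ r₀ →
      b * r ≤ μ.real (Metric.closedBall x r) ^ (1 / (d : ℝ)) := fun r hr hr' => by
    have e : b * r = (c * r ^ d) ^ (1 / (d : ℝ)) := by
      rw [Real.mul_rpow hc.le (by positivity), ← Real.rpow_natCast, ← Real.rpow_mul hr.le,
        mul_one_div_cancel hd0, Real.rpow_one]
    rw [e]
    exact Real.rpow_le_rpow (by positivity) (hpow r hr hr') (by positivity)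
  refine ⟨max (M / b) (1 / (b * r₀)), le_max_of_le_left (by positivity), fun r hr t => ?_⟩
  rcases le_total r r₀ with h | h
  · calc _ ≤ M * r := hM r hr t
      _ = M / b * (b * r) := by field_simp
      _ ≤ _ := by
        gcongr
        · exact le_max_left _ _
        · exact hroot r hr h
  · have h1 : |cdf (localOutputLaw μ ν g x r) t - cdf (outputLaw ν g x) t| ≤ 1 := by
      rw [abs_le]
      constructor <;> linarith [cdf_nonneg (localOutputLaw μ ν g x r) t,
        cdf_le_one (localOutputLaw μ ν g x r) t, cdf_nonneg (outputLaw ν g x) t,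
        cdf_le_one (outputLaw ν g x) t]
    calc _ ≤ 1 := h1
      _ = 1 / (b * r₀) * (b * r₀) := by field_simp
      _ ≤ _ := by
        gcongr
        · exact le_max_right _ _
        · refine (hroot r₀ hr₀ le_rfl).trans ?_
          refine Real.rpow_le_rpow measureReal_nonneg ?_ (by positivity)
          exact measureReal_mono (Metric.closedBall_subset_closedBall h)

/-! ### Order statistics -/

-- Together with `le_orderStat`, this turns counts of points in fixed balls into bounds on the
-- random radius. Nonnegativity keeps the infimum from being a default value.
open Classical in
theorem orderStat_le {s : ℕ → ℝ} (hs : ∀ i, 0 ≤ s i) {k n : ℕ} (hk : 1 ≤ k) {ρ : ℝ}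
    (h : k ≤ ((Finset.range n).filter (fun i => s i ≤ ρ)).card) : orderStat s k n ≤ ρ := by
  refine csInf_le ⟨0, fun w hw => ?_⟩ h
  obtain ⟨i, hi⟩ := Finset.card_pos.mp (lt_of_lt_of_le hk hw)
  exact (hs i).trans (Finset.mem_filter.mp hi).2

open Classical in
theorem le_orderStat {s : ℕ → ℝ} (hs : ∀ i, 0 ≤ s i) {k n : ℕ} (hkn : k ≤ n) {ρ : ℝ}
    (h : ((Finset.range n).filter (fun i => s i ≤ ρ)).card < k) : ρ ≤ orderStat s k n := by
  refine le_csInf ⟨∑ i ∈ Finset.range n, s i, ?_⟩ fun w hw => ?_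
  · show k ≤ _
    rw [Finset.filter_true_of_mem, Finset.card_range]
    · exact hkn
    · exact fun i hi => Finset.single_le_sum (f := s) (fun j _ => hs j) hi
  · by_contra! hlt
    refine absurd (hw.trans (Finset.card_le_card fun i hi => ?_)) (not_le.2 h)
    exact Finset.mem_filter.2 ⟨(Finset.mem_filter.1 hi).1,
      (Finset.mem_filter.1 hi).2.trans hlt.le⟩

theorem orderStat_congr {s t : ℕ → ℝ} {k n : ℕ} (h : ∀ i < n, s i = t i) :
    orderStat s k n = orderStat t k n := by
  classical
  unfold orderStat
  congr 1
  ext v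
  have : (Finset.range n).filter (fun i => s i ≤ v) = (Finset.range n).filter (fun i => t i ≤ v) :=
    Finset.filter_congr fun i hi => by rw [h i (Finset.mem_range.1 hi)]
  simp only [Set.mem_ofPred_eq]
  convert Iff.rfl using 3
  exact this.symm

theorem isNearestNeighbour_congr {d : ℕ} {x : Euc d} {X X' : ℕ → Euc d} {n k : ℕ}
    (h : ∀ i < n + 1, X i = X' i) :
    IsNearestNeighbour x X n k ↔ IsNearestNeighbour x X' n k := by
  classical
  unfold IsNearestNeighbour
  rw [Finset.filter_congr (q := fun i => ‖X' i - x‖ < ‖X' n - x‖) fun i hi => by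
    rw [h i (by have := Finset.mem_range.1 hi; omega), h n (by omega)]]

/-! ### The estimator -/

theorem theta_congr {d : ℕ} {α γ β θ₀ : ℝ} {x : Euc d} {X X' : ℕ → Euc d} {Y Y' : ℕ → ℝ} {n : ℕ}
    (hX : ∀ i < n, X i = X' i) (hY : ∀ i < n, Y i = Y' i) :
    theta α γ β θ₀ x X Y n = theta α γ β θ₀ x X' Y' n := by
  classical
  induction n with
  | zero => rfl
  | succ n ih =>
    have h1 := ih (fun i hi => hX i (by omega)) (fun i hi => hY i (by omega))
    rw [theta, theta, h1, hY n (by omega), if_congr (isNearestNeighbour_congr hX) rfl rfl]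

theorem rpow_neg_natCast_succ_le_one {γ : ℝ} (hγ : 0 ≤ γ) (n : ℕ) :
    ((n + 1 : ℕ) : ℝ) ^ (-γ) ≤ 1 :=
  Real.rpow_le_one_of_one_le_of_nonpos (by push_cast; linarith [n.cast_nonneg (α := ℝ)])
    (by linarith)

/-- Above A the indicator is 1 and θ cannot increase; below -A it is 0 and θ cannot decrease. Steps
have size at most 1, so an overshoot is at most 1. -/
theorem abs_theta_le {d : ℕ} {α γ β θ₀ : ℝ} {x : Euc d} {X : ℕ → Euc d} {Y : ℕ → ℝ} {A : ℝ}
    (hα : 0 ≤ α) (hα1 : α ≤ 1) (hγ : 0 ≤ γ) (hθ : |θ₀| ≤ A) (hY : ∀ i, |Y i| ≤ A) (n : ℕ) :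
    |theta α γ β θ₀ x X Y n| ≤ A + 1 := by
  induction n with
  | zero => exact hθ.trans (by linarith)
  | succ n ih =>
    rw [theta]
    set θ := theta α γ β θ₀ x X Y n
    have hs := rpow_neg_natCast_succ_le_one hγ n
    have hs0 : 0 ≤ ((n + 1 : ℕ) : ℝ) ^ (-γ) := by positivity
    set s := ((n + 1 : ℕ) : ℝ) ^ (-γ)
    rw [abs_le] at ih ⊢
    obtain ⟨hl, hu⟩ := abs_le.1 (hY n)
    split_ifs with h1 h2 <;> constructor <;> nlinarith

theorem measurableSet_isNearestNeighbour {d : ℕ} {Ω : Type*} [MeasurableSpace Ω] (x : Euc d)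
    {X : ℕ → Ω → Euc d} (hX : ∀ i, Measurable (X i)) (n k : ℕ) :
    MeasurableSet {ω | IsNearestNeighbour x (fun i => X i ω) n k} := by
  classical
  have h : Measurable fun ω => ∑ i ∈ Finset.range n,
      if ‖X i ω - x‖ < ‖X n ω - x‖ then 1 else 0 :=
    Finset.measurable_sum _ fun i _ => Measurable.ite
      (measurableSet_lt ((hX i).sub_const x).norm ((hX n).sub_const x).norm)
      measurable_const measurable_const
  have e : {ω | IsNearestNeighbour x (fun i => X i ω) n k} = {ω | (∑ i ∈ Finset.range n,
      if ‖X i ω - x‖ < ‖X n ω - x‖ then 1 else 0) < k} := by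
    ext ω
    rw [Set.mem_ofPred_eq, Set.mem_ofPred_eq, ← Finset.card_filter]
    rfl
  rw [e]
  exact measurableSet_lt h measurable_const

theorem measurable_theta {d : ℕ} {Ω : Type*} [MeasurableSpace Ω] (α γ β θ₀ : ℝ) (x : Euc d)
    {X : ℕ → Ω → Euc d} (hX : ∀ i, Measurable (X i)) {Y : ℕ → Ω → ℝ}
    (hY : ∀ i, Measurable (Y i)) (n : ℕ) :
    Measurable fun ω => theta α γ β θ₀ x (fun i => X i ω) (fun i => Y i ω) n := by
  classical
  induction n with
  | zero => exact measurable_const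
  | succ n ih =>
    simp only [theta]
    refine ih.sub ((((Measurable.ite (measurableSet_le (hY n) ih) measurable_const
      measurable_const).sub_const α).const_mul _).mul (Measurable.ite ?_ measurable_const
      measurable_const))
    exact measurableSet_isNearestNeighbour x hX n _

/-! ### Integration against the law of a sequence -/

theorem iIndepFun_eval_infinitePi {S : Type*} [MeasurableSpace S] (ρ : Measure S)
    [IsProbabilityMeasure ρ] :
    iIndepFun (fun (i : ℕ) (w : ℕ → S) => w i) (Measure.infinitePi fun _ => ρ) :=
  iIndepFun_infinitePi (X := fun _ => id) fun _ => measurable_id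

/-- The `n`-th coordinate can be integrated out first, if the function depends only on the first
`n + 1` coordinates. -/
theorem integral_infinitePi_eq_integral_update {S : Type*} [MeasurableSpace S] [Nonempty S]
    (ρ : Measure S) [IsProbabilityMeasure ρ] {n : ℕ} {F : (ℕ → S) → ℝ} (hF : Measurable F)
    (hdep : ∀ w w' : ℕ → S, (∀ i < n + 1, w i = w' i) → F w = F w') {C : ℝ}
    (hC : ∀ w, |F w| ≤ C) :
    ∫ w, F w ∂(Measure.infinitePi fun _ : ℕ => ρ) =
      ∫ w, ∫ z, F (Function.update w n z) ∂ρ ∂(Measure.infinitePi fun _ : ℕ => ρ) := by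
  classical
  set Q := Measure.infinitePi fun _ : ℕ => ρ with hQ
  obtain ⟨s₀⟩ := ‹Nonempty S›
  -- Freezing the coordinates from `n` on at `s₀` gives a variable independent of the `n`-th
  -- coordinate, and `F` does not see the change once that coordinate is restored.
  set past : (ℕ → S) → ℕ → S := fun w i => if i < n then w i else s₀ with hpast
  have hpm : Measurable past := measurable_pi_lambda _ fun i => by
    by_cases h : i < n
    · simpa [hpast, h] using measurable_pi_apply i
    · simp [hpast, h]
  have hind : IndepFun past (fun w => w n) Q := by
    have h := (iIndepFun_eval_infinitePi ρ).indepFun_finset (Finset.range n) {n} (by simp)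
      fun i => measurable_pi_apply i
    have h1 : Measurable fun (v : (Finset.range n) → S) (i : ℕ) =>
        if hi : i ∈ Finset.range n then v ⟨i, hi⟩ else s₀ := measurable_pi_lambda _ fun i => by
      by_cases hi : i ∈ Finset.range n
      · simpa only [hi, dif_pos] using measurable_pi_apply _
      · simp only [hi, dif_neg, not_false_eq_true, measurable_const]
    have h2 : Measurable fun (v : ({n} : Finset ℕ) → S) => v ⟨n, by simp⟩ := measurable_pi_apply _
    have h3 := h.comp h1 h2
    have e : past = (fun (v : (Finset.range n) → S) (i : ℕ) =>
        if hi : i ∈ Finset.range n then v ⟨i, hi⟩ else s₀) ∘ fun w i => w i := by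
      ext w i
      simp [hpast]
    rw [e]
    exact h3
  have hmap := (indepFun_iff_map_prod_eq_prod_map_map hpm.aemeasurable
    (measurable_pi_apply n).aemeasurable).1 hind
  have hn : Q.map (fun w => w n) = ρ := Measure.infinitePi_map_eval _ n
  rw [hn] at hmap
  have hprob : IsProbabilityMeasure (Q.map past) :=
    Measure.isProbabilityMeasure_map hpm.aemeasurable
  have hGm : Measurable fun p : (ℕ → S) × S => F (Function.update p.1 n p.2) := by
    exact hF.comp measurable_update'
  have hGi : Integrable (fun p : (ℕ → S) × S => F (Function.update p.1 n p.2))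
      ((Q.map past).prod ρ) :=
    Integrable.of_bound hGm.aestronglyMeasurable C (Eventually.of_forall fun p => hC _)
  calc ∫ w, F w ∂Q = ∫ w, F (Function.update (past w) n (w n)) ∂Q := by
        congr 1
        ext w
        refine hdep _ _ fun i hi => ?_
        by_cases h : i = n
        · subst h; simp
        · simp [Function.update_of_ne h, hpast, show i < n by omega]
    _ = ∫ p, F (Function.update p.1 n p.2) ∂(Q.map fun w => (past w, w n)) :=
        (integral_map (hpm.prodMk (measurable_pi_apply n)).aemeasurable
          hGm.aestronglyMeasurable).symm
    _ = ∫ v, ∫ z, F (Function.update v n z) ∂ρ ∂(Q.map past) := by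
        rw [hmap, integral_prod _ hGi]
    _ = ∫ w, ∫ z, F (Function.update (past w) n z) ∂ρ ∂Q :=
        integral_map hpm.aemeasurable hGi.integral_prod_left.aestronglyMeasurable
    _ = _ := by
        congr 1
        ext w
        congr 1
        ext z
        refine hdep _ _ fun i hi => ?_
        by_cases h : i = n
        · subst h; simp
        · simp [Function.update_of_ne h, hpast, show i < n by omega]

/-! ### Concentration of the number of points in a set -/

open Classical in
/-- The number of points of the sample `w 0, …, w (n - 1)` that lie in `B`. -/
noncomputable def sampleCount {S : Type*} (B : Set S) (n : ℕ) (w : ℕ → S) : ℕ :=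
  ((Finset.range n).filter fun i => w i ∈ B).card

theorem sampleCount_eq_sum {S : Type*} (B : Set S) (n : ℕ) (w : ℕ → S) :
    (sampleCount B n w : ℝ) = ∑ i ∈ Finset.range n, B.indicator (fun _ => (1 : ℝ)) (w i) := by
  classical
  rw [sampleCount, Finset.card_filter]
  push_cast
  exact Finset.sum_congr rfl fun i _ => by rw [Set.indicator_apply]

theorem measurable_sampleCount {S : Type*} [MeasurableSpace S] {B : Set S} (hB : MeasurableSet B)
    (n : ℕ) : Measurable fun w => (sampleCount B n w : ℝ) := by
  simp_rw [sampleCount_eq_sum]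
  exact Finset.measurable_sum _ fun i _ =>
    (measurable_const.indicator hB).comp (measurable_pi_apply i)

/-- The count is binomial, with moment generating function (1 + p(e^t - 1))^n; then 1 + u ≤ e^u. -/
theorem mgf_sampleCount_le {S : Type*} [MeasurableSpace S] (ρ : Measure S)
    [IsProbabilityMeasure ρ] {B : Set S} (hB : MeasurableSet B) (n : ℕ) (t : ℝ) :
    mgf (fun w => (sampleCount B n w : ℝ)) (Measure.infinitePi fun _ : ℕ => ρ) t
      ≤ Real.exp (n * (ρ.real B * (Real.exp t - 1))) := by
  set Q := Measure.infinitePi fun _ : ℕ => ρ with hQ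
  have hbm : Measurable (B.indicator fun _ => (1 : ℝ)) := measurable_const.indicator hB
  have hind : iIndepFun (fun (i : ℕ) (w : ℕ → S) => B.indicator (fun _ => (1 : ℝ)) (w i)) Q :=
    iIndepFun_infinitePi (X := fun _ => B.indicator fun _ => (1 : ℝ)) fun _ => hbm
  have hsum := hind.mgf_sum (t := t) (fun i => hbm.comp (measurable_pi_apply i)) (Finset.range n)
  have he : (fun w => (sampleCount B n w : ℝ))
      = ∑ i ∈ Finset.range n, fun w : ℕ → S => B.indicator (fun _ => (1 : ℝ)) (w i) := by
    ext w
    rw [sampleCount_eq_sum, Finset.sum_apply]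
  have hone : ∀ i : ℕ, mgf (fun w : ℕ → S => B.indicator (fun _ => (1 : ℝ)) (w i)) Q t
      = 1 + ρ.real B * (Real.exp t - 1) := fun i => by
    have h1 : ∫ w, Real.exp (t * B.indicator (fun _ => (1 : ℝ)) (w i)) ∂Q
        = ∫ z, Real.exp (t * B.indicator (fun _ => (1 : ℝ)) z) ∂(Q.map fun w => w i) :=
      (integral_map (φ := fun w : ℕ → S => w i) (measurable_pi_apply i).aemeasurable
        (Real.measurable_exp.comp (hbm.const_mul t)).aestronglyMeasurable).symm
    have h2 : (fun z => Real.exp (t * B.indicator (fun _ => (1 : ℝ)) z))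
        = fun z => 1 + B.indicator (fun _ => Real.exp t - 1) z := by
      ext z
      by_cases hz : z ∈ B <;> simp [hz]
    rw [mgf, h1, Measure.infinitePi_map_eval, h2, integral_add (integrable_const _)
      ((integrable_const _).indicator hB), integral_indicator hB]
    simp
  rw [he, hsum, Finset.prod_congr rfl fun i _ => hone i, Finset.prod_const, Finset.card_range,
    Real.exp_nat_mul]
  have h0 : 0 ≤ 1 + ρ.real B * (Real.exp t - 1) := by
    nlinarith [Real.exp_pos t, measureReal_nonneg (μ := ρ) (s := B),
      measureReal_le_one (μ := ρ) (s := B)]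
  exact pow_le_pow_left₀ h0 (by linarith [Real.add_one_le_exp (ρ.real B * (Real.exp t - 1))]) n

theorem integrable_exp_mul_sampleCount {S : Type*} [MeasurableSpace S] (ρ : Measure S)
    [IsProbabilityMeasure ρ] {B : Set S} (hB : MeasurableSet B) (n : ℕ) (t : ℝ) :
    Integrable (fun w => Real.exp (t * (sampleCount B n w : ℝ)))
      (Measure.infinitePi fun _ : ℕ => ρ) := by
  refine Integrable.of_bound (Real.measurable_exp.comp
    ((measurable_sampleCount hB n).const_mul t)).aestronglyMeasurable (Real.exp (|t| * n))
    (Eventually.of_forall fun w => ?_)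
  rw [Real.norm_eq_abs, Real.abs_exp, Real.exp_le_exp]
  have h : (sampleCount B n w : ℝ) ≤ n := by
    classical
    exact_mod_cast (Finset.card_filter_le _ _).trans (Finset.card_range n).le
  calc t * (sampleCount B n w : ℝ) ≤ |t| * (sampleCount B n w : ℝ) := by
        gcongr; exact le_abs_self t
    _ ≤ |t| * n := by gcongr

/-- Chernoff's bound at t = 1, with e - 1 ≤ 2. -/
theorem measureReal_le_sampleCount {S : Type*} [MeasurableSpace S] (ρ : Measure S)
    [IsProbabilityMeasure ρ] {B : Set S} (hB : MeasurableSet B) (n k : ℕ) :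
    (Measure.infinitePi fun _ : ℕ => ρ).real {w | k ≤ sampleCount B n w}
      ≤ Real.exp (2 * (n * ρ.real B) - k) := by
  have h := measure_ge_le_exp_mul_mgf (k : ℝ) zero_le_one
    (integrable_exp_mul_sampleCount ρ hB n 1)
  simp only [Nat.cast_le] at h
  refine h.trans ?_
  refine (mul_le_mul_of_nonneg_left (mgf_sampleCount_le ρ hB n 1) (Real.exp_pos _).le).trans ?_
  rw [← Real.exp_add, Real.exp_le_exp]
  have h1 : Real.exp 1 - 1 ≤ 2 := by linarith [Real.exp_one_lt_d9]
  have h2 : 0 ≤ (n : ℝ) * ρ.real B := by positivity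
  nlinarith

/-- Chernoff's bound at t = -1, with 1 - 1/e ≥ 1/2. -/
theorem measureReal_sampleCount_lt {S : Type*} [MeasurableSpace S] (ρ : Measure S)
    [IsProbabilityMeasure ρ] {B : Set S} (hB : MeasurableSet B) (n k : ℕ) :
    (Measure.infinitePi fun _ : ℕ => ρ).real {w | sampleCount B n w < k}
      ≤ Real.exp (k - n * ρ.real B / 2) := by
  have h := measure_le_le_exp_mul_mgf (k : ℝ) (show (-1 : ℝ) ≤ 0 by norm_num)
    (integrable_exp_mul_sampleCount ρ hB n (-1))
  simp only [Nat.cast_le] at h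
  have hsub : {w : ℕ → S | sampleCount B n w < k} ⊆ {w | sampleCount B n w ≤ k} :=
    fun w hw => by
      simp only [Set.mem_ofPred_eq] at hw ⊢
      exact hw.le
  refine (measureReal_mono hsub).trans (h.trans ?_)
  refine (mul_le_mul_of_nonneg_left (mgf_sampleCount_le ρ hB n (-1)) (Real.exp_pos _).le).trans ?_
  rw [← Real.exp_add, Real.exp_le_exp]
  have h1 : Real.exp (-1) ≤ 1 / 2 := by
    rw [Real.exp_neg, inv_eq_one_div]
    exact one_div_le_one_div_of_le two_pos (by linarith [Real.add_one_le_exp (1 : ℝ)])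
  have h2 : 0 ≤ (n : ℝ) * ρ.real B := by positivity
  nlinarith

/-! ### One step of the algorithm -/

theorem measureReal_prod_fst_preimage {S T : Type*} [MeasurableSpace S] [MeasurableSpace T]
    (μ : Measure S) (ν : Measure T) [IsProbabilityMeasure ν] (B : Set S) :
    (μ.prod ν).real (Prod.fst ⁻¹' B) = μ.real B := by
  rw [← Set.prod_univ, measureReal_def, Measure.prod_prod]
  simp [measureReal_def]

open Classical in
theorem integral_step_eq {d m : ℕ} (μ : Measure (Euc d)) [IsProbabilityMeasure μ]
    (ν : Measure (Euc m)) [IsProbabilityMeasure ν] {g : Euc d → Euc m → ℝ}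
    (hg : Measurable fun p : Euc d × Euc m => g p.1 p.2) (x : Euc d) (α θ r : ℝ) :
    ∫ z, ((if g z.1 z.2 ≤ θ then (1 : ℝ) else 0) - α) * (if ‖z.1 - x‖ ≤ r then 1 else 0)
        ∂(μ.prod ν)
      = μ.real (Metric.closedBall x r) * (cdf (localOutputLaw μ ν g x r) θ - α) := by
  set B : Set (Euc d × Euc m) := Prod.fst ⁻¹' Metric.closedBall x r with hB
  set T : Set (Euc d × Euc m) := {z | g z.1 z.2 ≤ θ} with hT
  have hBm : MeasurableSet B := measurable_fst Metric.isClosed_closedBall.measurableSet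
  have hTm : MeasurableSet T := measurableSet_le hg measurable_const
  have hp : (μ.prod ν).real B = μ.real (Metric.closedBall x r) :=
    measureReal_prod_fst_preimage μ ν _
  have e : (fun z : Euc d × Euc m => ((if g z.1 z.2 ≤ θ then (1 : ℝ) else 0) - α)
      * (if ‖z.1 - x‖ ≤ r then 1 else 0))
      = fun z => (B ∩ T).indicator (fun _ => (1 : ℝ)) z - B.indicator (fun _ => α) z := by
    ext z
    have hzB : ‖z.1 - x‖ ≤ r ↔ z ∈ B := by simp [hB, dist_eq_norm]
    have hzT : z ∈ T ↔ g z.1 z.2 ≤ θ := Iff.rfl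
    by_cases h1 : z ∈ B <;> by_cases h2 : g z.1 z.2 ≤ θ <;>
      simp [hzB, hzT, h1, h2]
  rw [e, integral_sub ((integrable_const _).indicator (hBm.inter hTm))
    ((integrable_const _).indicator hBm), integral_indicator (hBm.inter hTm),
    integral_indicator hBm]
  simp only [integral_const, MeasurableSet.univ, measureReal_restrict_apply, Set.univ_inter,
    smul_eq_mul, mul_one]
  rw [← hp]
  -- For a ball of mass zero the conditional law is meaningless, but the factor in front of it
  -- vanishes.
  by_cases h0 : (μ.prod ν).real B = 0
  · have : (μ.prod ν).real (B ∩ T) = 0 :=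
      le_antisymm (h0 ▸ measureReal_mono Set.inter_subset_left) measureReal_nonneg
    rw [this, h0]
    ring
  · have h0' : (μ.prod ν) B ≠ 0 := fun h => h0 (by simp [measureReal_def, h])
    have : IsProbabilityMeasure (cond (μ.prod ν) B) := cond_isProbabilityMeasure h0'
    have hprob : IsProbabilityMeasure (localOutputLaw μ ν g x r) :=
      Measure.isProbabilityMeasure_map hg.aemeasurable
    have hc : cdf (localOutputLaw μ ν g x r) θ
        = ((μ.prod ν).real B)⁻¹ * (μ.prod ν).real (B ∩ T) := by
      rw [cdf_eq_real, localOutputLaw, map_measureReal_apply hg measurableSet_Iic]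
      show (cond (μ.prod ν) B).real T = _
      rw [measureReal_def, cond_apply hBm, ENNReal.toReal_mul, ENNReal.toReal_inv]
      rfl
    rw [hc]
    field_simp

open Classical in
/-- The mean square error after one step, when the neighbours of `x` are the points at distance at
most `r`. -/
theorem integral_step_sq_le {d m : ℕ} (hd : 1 ≤ d) (μ : Measure (Euc d)) [IsProbabilityMeasure μ]
    (hμ : μ ≪ volume)
    (ν : Measure (Euc m)) [IsProbabilityMeasure ν] {g : Euc d → Euc m → ℝ}
    (hg : Measurable fun p : Euc d × Euc m => g p.1 p.2) {x : Euc d} {α q K c C : ℝ}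
    (hα : 0 ≤ α) (hα1 : α ≤ 1)
    (hlip : ∀ r : ℝ, 0 < r → ∀ t : ℝ,
      |cdf (localOutputLaw μ ν g x r) t - cdf (outputLaw ν g x) t|
        ≤ C * μ.real (Metric.closedBall x r) ^ (1 / (d : ℝ)))
    {θ : ℝ} (hθ : |θ - q| ≤ K)
    (hquad : c * (θ - q) ^ 2 ≤ (θ - q) * (cdf (outputLaw ν g x) θ - α))
    {s : ℝ} (hs : 0 ≤ s) (r : ℝ) :
    ∫ z, (θ - s * ((if g z.1 z.2 ≤ θ then (1 : ℝ) else 0) - α)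
        * (if ‖z.1 - x‖ ≤ r then 1 else 0) - q) ^ 2 ∂(μ.prod ν)
      ≤ (1 - 2 * c * s * μ.real (Metric.closedBall x r)) * (θ - q) ^ 2
        + 2 * K * C * s * μ.real (Metric.closedBall x r) ^ (1 + 1 / (d : ℝ))
        + s ^ 2 * μ.real (Metric.closedBall x r) := by
  have : Nonempty (Fin d) := ⟨⟨0, hd⟩⟩
  have : Nontrivial (Euc d) := inferInstance
  set p := μ.real (Metric.closedBall x r) with hp
  have hp0 : 0 ≤ p := measureReal_nonneg
  set B : Set (Euc d × Euc m) := Prod.fst ⁻¹' Metric.closedBall x r with hB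
  have hBm : MeasurableSet B := measurable_fst Metric.isClosed_closedBall.measurableSet
  have hpB : (μ.prod ν).real B = p := measureReal_prod_fst_preimage μ ν _
  have hzB : ∀ z : Euc d × Euc m, ‖z.1 - x‖ ≤ r ↔ z ∈ B := fun z => by simp [hB, dist_eq_norm]
  set J : Euc d × Euc m → ℝ := fun z => ((if g z.1 z.2 ≤ θ then (1 : ℝ) else 0) - α)
    * (if ‖z.1 - x‖ ≤ r then 1 else 0) with hJ
  have hJm : Measurable J := by
    refine ((Measurable.ite (measurableSet_le hg measurable_const) measurable_const
      measurable_const).sub_const α).mul (Measurable.ite ?_ measurable_const measurable_const)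
    exact measurableSet_le (measurable_fst.sub_const x).norm measurable_const
  have hJ1 : ∀ z, |J z| ≤ 1 := fun z => by
    rw [abs_le]; simp only [hJ]; split_ifs <;> constructor <;> linarith
  have hJ2 : ∀ z, J z ^ 2 ≤ B.indicator (fun _ => (1 : ℝ)) z := fun z => by
    by_cases hz : z ∈ B
    · rw [Set.indicator_of_mem hz, ← sq_abs]
      exact pow_le_one₀ (abs_nonneg _) (hJ1 z)
    · rw [Set.indicator_of_notMem hz]
      simp [hJ, hzB, hz]
  have hJi : Integrable J (μ.prod ν) :=
    Integrable.of_bound hJm.aestronglyMeasurable 1 (Eventually.of_forall hJ1)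
  have hBi : Integrable (B.indicator fun _ => (1 : ℝ)) (μ.prod ν) :=
    (integrable_const _).indicator hBm
  have hle : ∫ z, (θ - s * ((if g z.1 z.2 ≤ θ then (1 : ℝ) else 0) - α)
        * (if ‖z.1 - x‖ ≤ r then 1 else 0) - q) ^ 2 ∂(μ.prod ν)
      ≤ ∫ z, ((θ - q) ^ 2 - 2 * s * (θ - q) * J z
        + s ^ 2 * B.indicator (fun _ => (1 : ℝ)) z) ∂(μ.prod ν) := by
    refine integral_mono_of_nonneg (Eventually.of_forall fun z => sq_nonneg _)
      (((integrable_const _).sub (hJi.const_mul _)).add (hBi.const_mul _))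
      (Eventually.of_forall fun z => ?_)
    have e : (θ - s * ((if g z.1 z.2 ≤ θ then (1 : ℝ) else 0) - α)
        * (if ‖z.1 - x‖ ≤ r then 1 else 0) - q) ^ 2
        = (θ - q) ^ 2 - 2 * s * (θ - q) * J z + s ^ 2 * J z ^ 2 := by
      simp only [hJ]; ring
    show _ ^ 2 ≤ _
    rw [e]
    exact add_le_add_right (mul_le_mul_of_nonneg_left (hJ2 z) (sq_nonneg s)) _
  have hI : ∫ z, ((θ - q) ^ 2 - 2 * s * (θ - q) * J z
        + s ^ 2 * B.indicator (fun _ => (1 : ℝ)) z) ∂(μ.prod ν)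
      = (θ - q) ^ 2 - 2 * s * (θ - q) * (p * (cdf (localOutputLaw μ ν g x r) θ - α))
        + s ^ 2 * p := by
    have h1 : Integrable (fun z => (θ - q) ^ 2 - 2 * s * (θ - q) * J z) (μ.prod ν) :=
      (integrable_const _).sub (hJi.const_mul _)
    rw [integral_add h1 (hBi.const_mul _), integral_sub (integrable_const _) (hJi.const_mul _),
      integral_const_mul, integral_const_mul,
      integral_indicator hBm, integral_step_eq μ ν hg x α θ r]
    simp [hpB, ← hp]
  refine hle.trans (hI.le.trans ?_)
  -- The drift splits into the part of the law at `x`, which contracts, and the bias of the ball, at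
  -- most C p^(1/d), multiplied by |θ - q| ≤ K.
  have hkey : p * (c * (θ - q) ^ 2) - K * C * p ^ (1 + 1 / (d : ℝ))
      ≤ p * ((θ - q) * (cdf (localOutputLaw μ ν g x r) θ - α)) := by
    have hd0 : (0 : ℝ) < d := by exact_mod_cast hd
    rcases hp0.eq_or_lt with h0 | h0
    · rw [← h0, Real.zero_rpow (by positivity)]
      simp
    · have hr : 0 < r := by
        by_contra! hr
        refine h0.ne' ?_
        rw [hp, measureReal_eq_zero_iff]
        refine hμ ?_
        rcases hr.lt_or_eq with h | h
        · rw [Metric.closedBall_eq_empty.2 h]; simp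
        · rw [h, Metric.closedBall_zero]; simp
      have hl := hlip r hr θ
      rw [Real.rpow_add h0, Real.rpow_one]
      set y := p ^ (1 / (d : ℝ))
      have hy : 0 ≤ C * y := (abs_nonneg _).trans hl
      have h1 : -(K * (C * y)) ≤ (θ - q) *
          (cdf (localOutputLaw μ ν g x r) θ - cdf (outputLaw ν g x) θ) := by
        refine (abs_le.1 ?_).1
        rw [abs_mul]
        exact mul_le_mul hθ hl (abs_nonneg _) ((abs_nonneg _).trans hθ)
      nlinarith
  nlinarith

/-! ### The squared error on the space of sequences -/

/-- The squared error as a function of the sequence of samples. -/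
noncomputable def seqSqError {d m : ℕ} (ν : Measure (Euc m)) (g : Euc d → Euc m → ℝ)
    (α γ β θ₀ : ℝ) (x : Euc d) (n : ℕ) (w : ℕ → Euc d × Euc m) : ℝ :=
  sqError ν g α γ β θ₀ x (fun i w => (w i).1) (fun i w => (w i).2) n w

theorem measurable_seqSqError {d m : ℕ} (ν : Measure (Euc m)) {g : Euc d → Euc m → ℝ}
    (hg : Measurable fun p : Euc d × Euc m => g p.1 p.2) (α γ β θ₀ : ℝ) (x : Euc d) (n : ℕ) :
    Measurable (seqSqError ν g α γ β θ₀ x n) := by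
  have h : Measurable fun w : ℕ → Euc d × Euc m =>
      theta α γ β θ₀ x (fun i => (w i).1) (fun i => g (w i).1 (w i).2) n :=
    measurable_theta (X := fun i (w : ℕ → Euc d × Euc m) => (w i).1)
      (Y := fun i (w : ℕ → Euc d × Euc m) => g (w i).1 (w i).2) α γ β θ₀ x
      (fun i => measurable_fst.comp (measurable_pi_apply i))
      (fun i => hg.comp (measurable_pi_apply i)) n
  exact (h.sub_const _).pow_const 2

theorem seqSqError_congr {d m : ℕ} {ν : Measure (Euc m)} {g : Euc d → Euc m → ℝ} {α γ β θ₀ : ℝ}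
    {x : Euc d} {n : ℕ} {w w' : ℕ → Euc d × Euc m} (h : ∀ i < n, w i = w' i) :
    seqSqError ν g α γ β θ₀ x n w = seqSqError ν g α γ β θ₀ x n w' := by
  unfold seqSqError sqError
  rw [theta_congr (X' := fun i => (w' i).1) (Y' := fun i => g (w' i).1 (w' i).2)
    (fun i hi => by simp only [h i hi]) (fun i hi => by simp only [h i hi])]

-- With the past fixed, the order statistic is a constant and the neighbour test becomes membership
-- of `z` in a fixed ball, the setting of `integral_step_sq_le`.
open Classical in
theorem seqSqError_update {d m : ℕ} {ν : Measure (Euc m)} {g : Euc d → Euc m → ℝ} {α γ β θ₀ : ℝ}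
    {x : Euc d} {n : ℕ} (hk : 1 ≤ numNeighbours β (n + 1)) (hkn : numNeighbours β (n + 1) ≤ n)
    (w : ℕ → Euc d × Euc m) (z : Euc d × Euc m) :
    seqSqError ν g α γ β θ₀ x (n + 1) (Function.update w n z) =
      (theta α γ β θ₀ x (fun i => (w i).1) (fun i => g (w i).1 (w i).2) n -
        ((n + 1 : ℕ) : ℝ) ^ (-γ) * ((if g z.1 z.2 ≤ theta α γ β θ₀ x (fun i => (w i).1)
          (fun i => g (w i).1 (w i).2) n then 1 else 0) - α) *
        (if ‖z.1 - x‖ ≤ orderStat (fun i => ‖(w i).1 - x‖) (numNeighbours β (n + 1)) n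
          then 1 else 0) - quantile (outputLaw ν g x) α) ^ 2 := by
  have hlt : ∀ i < n, Function.update w n z i = w i := fun i hi =>
    Function.update_of_ne (by omega) _ _
  have hθ : theta α γ β θ₀ x (fun i => (Function.update w n z i).1)
      (fun i => g (Function.update w n z i).1 (Function.update w n z i).2) n
      = theta α γ β θ₀ x (fun i => (w i).1) (fun i => g (w i).1 (w i).2) n :=
    theta_congr (fun i hi => by rw [hlt i hi]) (fun i hi => by rw [hlt i hi])
  have ho : orderStat (fun i => ‖(Function.update w n z i).1 - x‖) (numNeighbours β (n + 1)) n
      = orderStat (fun i => ‖(w i).1 - x‖) (numNeighbours β (n + 1)) n :=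
    orderStat_congr fun i hi => by rw [hlt i hi]
  have hnn := isNearestNeighbour_iff x (fun i => (Function.update w n z i).1) n
    (numNeighbours β (n + 1)) hk hkn
  rw [ho] at hnn
  simp only [Function.update_self] at hnn
  rw [seqSqError, sqError, theta, hθ, if_congr hnn rfl rfl]
  simp only [Function.update_self]

theorem seqSqError_le {d m : ℕ} {ν : Measure (Euc m)} {g : Euc d → Euc m → ℝ} {α γ β θ₀ : ℝ}
    {x : Euc d} {A : ℝ} (hα : 0 ≤ α) (hα1 : α ≤ 1) (hγ : 0 ≤ γ) (hθ : |θ₀| ≤ A)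
    (hg : ∀ z e, |g z e| ≤ A) (hq : |quantile (outputLaw ν g x) α| ≤ A) (n : ℕ)
    (w : ℕ → Euc d × Euc m) :
    |theta α γ β θ₀ x (fun i => (w i).1) (fun i => g (w i).1 (w i).2) n
        - quantile (outputLaw ν g x) α| ≤ 2 * A + 1 ∧
      |seqSqError ν g α γ β θ₀ x n w| ≤ (2 * A + 1) ^ 2 := by
  have h1 : |theta α γ β θ₀ x (fun i => (w i).1) (fun i => g (w i).1 (w i).2) n
        - quantile (outputLaw ν g x) α| ≤ 2 * A + 1 :=
    (abs_sub _ _).trans (by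
      linarith [abs_theta_le (β := β) (x := x) (X := fun i => (w i).1)
        (Y := fun i => g (w i).1 (w i).2) hα hα1 hγ hθ (fun i => hg _ _) n])
  refine ⟨h1, ?_⟩
  rw [seqSqError, sqError, abs_pow]
  exact pow_le_pow_left₀ (abs_nonneg _) h1 2

/-- The recursive inequality for the mean square error. -/
theorem integral_seqSqError_succ_le {d m : ℕ} (hd : 1 ≤ d)
    {μ : Measure (Euc d)} [IsProbabilityMeasure μ] (hμ : μ ≪ volume)
    {ν : Measure (Euc m)} [IsProbabilityMeasure ν] {g : Euc d → Euc m → ℝ}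
    (hg : Measurable fun p : Euc d × Euc m => g p.1 p.2) {x : Euc d} {α γ β θ₀ A c C : ℝ}
    (hα : 0 ≤ α) (hα1 : α ≤ 1) (hγ : 0 ≤ γ) (hθ : |θ₀| ≤ A) (hgA : ∀ z e, |g z e| ≤ A)
    (hq : |quantile (outputLaw ν g x) α| ≤ A) (hC : 0 ≤ C)
    (hlip : ∀ r : ℝ, 0 < r → ∀ t : ℝ,
      |cdf (localOutputLaw μ ν g x r) t - cdf (outputLaw ν g x) t|
        ≤ C * μ.real (Metric.closedBall x r) ^ (1 / (d : ℝ)))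
    (hc : 0 ≤ c) (hc1 : 2 * c ≤ 1)
    (hquad : ∀ t : ℝ, |t - quantile (outputLaw ν g x) α| ≤ 2 * A + 1 →
      c * (t - quantile (outputLaw ν g x) α) ^ 2
        ≤ (t - quantile (outputLaw ν g x) α) * (cdf (outputLaw ν g x) t - α))
    {n : ℕ} (hk : 1 ≤ numNeighbours β (n + 1)) (hkn : numNeighbours β (n + 1) ≤ n)
    {δ₁ δ₂ : ℝ} (h0 : 0 < δ₁) (h1 : δ₁ < 1) (h0' : 0 < δ₂) (h1' : δ₂ < 1) :
    ∫ w, seqSqError ν g α γ β θ₀ x (n + 1) w ∂(Measure.infinitePi fun _ : ℕ => μ.prod ν) ≤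
      (1 - 2 * c * ((n + 1 : ℕ) : ℝ) ^ (-γ) * δ₁) *
        ∫ w, seqSqError ν g α γ β θ₀ x n w ∂(Measure.infinitePi fun _ : ℕ => μ.prod ν)
      + 2 * (2 * A + 1) * C * ((n + 1 : ℕ) : ℝ) ^ (-γ) * δ₂ ^ (1 + 1 / (d : ℝ))
      + (((n + 1 : ℕ) : ℝ) ^ (-γ)) ^ 2 * δ₂
      + (2 * A + 1) ^ 2 * (Real.exp (2 * (n * δ₁) - numNeighbours β (n + 1))
        + Real.exp (numNeighbours β (n + 1) - n * δ₂ / 2)) := by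
  classical
  set Q := Measure.infinitePi fun _ : ℕ => μ.prod ν with hQ
  set k := numNeighbours β (n + 1) with hkdef
  set s := ((n + 1 : ℕ) : ℝ) ^ (-γ) with hs
  set q := quantile (outputLaw ν g x) α with hqdef
  have hs0 : 0 ≤ s := by positivity
  have hs1 : s ≤ 1 := rpow_neg_natCast_succ_le_one hγ n
  have hA : 0 ≤ A := (abs_nonneg _).trans hθ
  have hd0 : (0 : ℝ) < d := by exact_mod_cast hd
  obtain ⟨ρ₁, hρ₁⟩ := exists_closedBall_measureReal_eq hd hμ x h0 h1
  obtain ⟨ρ₂, hρ₂⟩ := exists_closedBall_measureReal_eq hd hμ x h0' h1'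
  set B : ℝ → Set (Euc d × Euc m) := fun ρ => Prod.fst ⁻¹' Metric.closedBall x ρ with hB
  have hBm : ∀ ρ, MeasurableSet (B ρ) := fun ρ =>
    measurable_fst Metric.isClosed_closedBall.measurableSet
  have hBr : ∀ ρ, (μ.prod ν).real (B ρ) = μ.real (Metric.closedBall x ρ) := fun ρ =>
    measureReal_prod_fst_preimage μ ν _
  have hcount : ∀ ρ (w : ℕ → Euc d × Euc m), sampleCount (B ρ) n w
      = ((Finset.range n).filter fun i => ‖(w i).1 - x‖ ≤ ρ).card := fun ρ w => by
    simp [sampleCount, hB, dist_eq_norm]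
  -- The bad events: too many points in the ball of mass `δ₁`, or too few in the ball of mass `δ₂`.
  -- Outside them the neighbour radius lies between `ρ₁` and `ρ₂`.
  set G₁ : Set (ℕ → Euc d × Euc m) := {w | k ≤ sampleCount (B ρ₁) n w} with hG₁
  set G₂ : Set (ℕ → Euc d × Euc m) := {w | sampleCount (B ρ₂) n w < k} with hG₂
  have hGm₁ : MeasurableSet G₁ := by
    have := measurableSet_le (measurable_const (a := (k : ℝ)))
      (measurable_sampleCount (hBm ρ₁) n)
    simpa only [Nat.cast_le] using this
  have hGm₂ : MeasurableSet G₂ := by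
    have := measurableSet_lt (measurable_sampleCount (hBm ρ₂) n)
      (measurable_const (a := (k : ℝ)))
    simpa only [Nat.cast_lt] using this
  have hP₁ : Q.real G₁ ≤ Real.exp (2 * (n * δ₁) - k) := by
    have := measureReal_le_sampleCount (μ.prod ν) (hBm ρ₁) n k
    rwa [hBr, hρ₁] at this
  have hP₂ : Q.real G₂ ≤ Real.exp (k - n * δ₂ / 2) := by
    have := measureReal_sampleCount_lt (μ.prod ν) (hBm ρ₂) n k
    rwa [hBr, hρ₂] at this
  have hbd := fun n w => seqSqError_le (β := β) (w := w) hα hα1 hγ hθ hgA hq n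
  have hmeas := measurable_seqSqError ν hg α γ β θ₀ x
  set E := 2 * (2 * A + 1) * C * s * δ₂ ^ (1 + 1 / (d : ℝ)) + s ^ 2 * δ₂ with hE
  have hE0 : 0 ≤ E := by positivity
  have hcon : 0 ≤ 1 - 2 * c * s * δ₁ := by
    have : 2 * c * s * δ₁ ≤ 1 * 1 * 1 := by gcongr
    linarith
  have hinner : ∀ w, ∫ z, seqSqError ν g α γ β θ₀ x (n + 1) (Function.update w n z) ∂(μ.prod ν)
      ≤ (1 - 2 * c * s * δ₁) * seqSqError ν g α γ β θ₀ x n w + E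
        + (G₁.indicator (fun _ => (2 * A + 1) ^ 2) w
          + G₂.indicator (fun _ => (2 * A + 1) ^ 2) w) := by
    intro w
    have hFn : 0 ≤ seqSqError ν g α γ β θ₀ x n w := sq_nonneg _
    have hi₁ : 0 ≤ G₁.indicator (fun _ => (2 * A + 1) ^ 2) w :=
      Set.indicator_nonneg (fun _ _ => sq_nonneg _) _
    have hi₂ : 0 ≤ G₂.indicator (fun _ => (2 * A + 1) ^ 2) w :=
      Set.indicator_nonneg (fun _ _ => sq_nonneg _) _
    -- On a bad event the uniform bound on the error is enough, since these events are rare.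
    by_cases hw : w ∈ G₁ ∨ w ∈ G₂
    · have hle : ∫ z, seqSqError ν g α γ β θ₀ x (n + 1) (Function.update w n z) ∂(μ.prod ν)
          ≤ (2 * A + 1) ^ 2 := by
        refine (integral_mono_of_nonneg (Eventually.of_forall fun z => sq_nonneg _)
          (integrable_const ((2 * A + 1) ^ 2))
          (Eventually.of_forall fun z => (le_abs_self _).trans (hbd (n + 1) _).2)).trans ?_
        simp
      have h2 : (2 * A + 1) ^ 2 ≤ G₁.indicator (fun _ => (2 * A + 1) ^ 2) w
          + G₂.indicator (fun _ => (2 * A + 1) ^ 2) w := by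
        rcases hw with hw | hw
        · rw [Set.indicator_of_mem hw]; linarith
        · rw [Set.indicator_of_mem hw]; linarith
      have h3 := mul_nonneg hcon hFn
      linarith
    · push Not at hw
      obtain ⟨hw1, hw2⟩ := hw
      simp only [hG₁, hG₂, Set.mem_ofPred_eq, not_le, not_lt] at hw1 hw2
      rw [hcount] at hw1 hw2
      set r := orderStat (fun i => ‖(w i).1 - x‖) k n with hr
      have hr1 : ρ₁ ≤ r := le_orderStat (fun i => norm_nonneg _) hkn hw1
      have hr2 : r ≤ ρ₂ := orderStat_le (fun i => norm_nonneg _) hk hw2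
      have hp1 : δ₁ ≤ μ.real (Metric.closedBall x r) :=
        hρ₁ ▸ measureReal_mono (Metric.closedBall_subset_closedBall hr1)
      have hp2 : μ.real (Metric.closedBall x r) ≤ δ₂ :=
        hρ₂ ▸ measureReal_mono (Metric.closedBall_subset_closedBall hr2)
      simp_rw [seqSqError_update hk hkn w]
      have hθw := (hbd n w).1
      refine (integral_step_sq_le hd μ hμ ν hg hα hα1 hlip hθw (hquad _ hθw) hs0 r).trans ?_
      change _ ≤ (1 - 2 * c * s * δ₁) * (theta α γ β θ₀ x (fun i => (w i).1)
        (fun i => g (w i).1 (w i).2) n - q) ^ 2 + E + _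
      have e1 : (1 - 2 * c * s * μ.real (Metric.closedBall x r)) * (theta α γ β θ₀ x
          (fun i => (w i).1) (fun i => g (w i).1 (w i).2) n - q) ^ 2
          ≤ (1 - 2 * c * s * δ₁) * (theta α γ β θ₀ x (fun i => (w i).1)
          (fun i => g (w i).1 (w i).2) n - q) ^ 2 := by gcongr
      have e2 : 2 * (2 * A + 1) * C * s * μ.real (Metric.closedBall x r) ^ (1 + 1 / (d : ℝ))
          ≤ 2 * (2 * A + 1) * C * s * δ₂ ^ (1 + 1 / (d : ℝ)) := by gcongr
      have e3 : s ^ 2 * μ.real (Metric.closedBall x r) ≤ s ^ 2 * δ₂ := by gcongr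
      linarith
  have hint : Integrable (seqSqError ν g α γ β θ₀ x n) Q :=
    Integrable.of_bound (hmeas n).aestronglyMeasurable _ (Eventually.of_forall fun w => (hbd n w).2)
  have hi1 : Integrable (fun w => (1 - 2 * c * s * δ₁) * seqSqError ν g α γ β θ₀ x n w + E) Q :=
    (hint.const_mul _).add (integrable_const _)
  have hg1 : Integrable (G₁.indicator fun _ => (2 * A + 1) ^ 2) Q :=
    (integrable_const _).indicator hGm₁
  have hg2 : Integrable (G₂.indicator fun _ => (2 * A + 1) ^ 2) Q :=
    (integrable_const _).indicator hGm₂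
  have hg12 : Integrable (fun w => G₁.indicator (fun _ => (2 * A + 1) ^ 2) w
      + G₂.indicator (fun _ => (2 * A + 1) ^ 2) w) Q := hg1.add hg2
  rw [integral_infinitePi_eq_integral_update (μ.prod ν) (hmeas (n + 1))
    (fun w w' h => seqSqError_congr h) (fun w => (hbd (n + 1) w).2)]
  refine (integral_mono_of_nonneg (Eventually.of_forall fun w => integral_nonneg fun z =>
    sq_nonneg _) (hi1.add hg12) (Eventually.of_forall hinner)).trans ?_
  rw [integral_add' hi1 hg12, integral_add (hint.const_mul _) (integrable_const _),
    integral_add hg1 hg2, integral_const_mul, integral_indicator hGm₁, integral_indicator hGm₂]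
  simp only [integral_const, MeasurableSet.univ, measureReal_restrict_apply, Set.univ_inter,
    smul_eq_mul, probReal_univ, one_mul]
  have := mul_le_mul_of_nonneg_left (add_le_add hP₁ hP₂) (sq_nonneg (2 * A + 1))
  linarith

/-! ### Choice of the mass levels and the resulting rate. -/

/-- Write N = n + 1. The number of neighbours is N^β up to the floor. A ball of mass N^(-ε) has
about N^(1-ε) = o(N^β) points, while the factor 8 makes n δ₂/2 at least 2N^β. Both exponents are
thus at most 1 - N^β/2, which beats any power. -/
theorem eventually_exp_tail_le {β ε : ℝ} (hβ : 0 < β) (hβ1 : β < 1) (hε : 1 - β < ε) (p : ℝ) :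
    ∀ᶠ n : ℕ in atTop, 1 ≤ numNeighbours β (n + 1) ∧ numNeighbours β (n + 1) ≤ n ∧
      ((n + 1 : ℕ) : ℝ) ^ (-ε) < 1 ∧ 8 * ((n + 1 : ℕ) : ℝ) ^ (β - 1) < 1 ∧
      Real.exp (2 * (n * ((n + 1 : ℕ) : ℝ) ^ (-ε)) - numNeighbours β (n + 1))
        + Real.exp (numNeighbours β (n + 1) - n * (8 * ((n + 1 : ℕ) : ℝ) ^ (β - 1)) / 2)
        ≤ ((n + 1 : ℕ) : ℝ) ^ (-p) := by
  have hcast : Tendsto (fun n : ℕ => ((n + 1 : ℕ) : ℝ)) atTop atTop :=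
    tendsto_natCast_atTop_atTop.comp (tendsto_add_atTop_nat 1)
  have h1 : ∀ᶠ n : ℕ in atTop, (8 : ℝ) < ((n + 1 : ℕ) : ℝ) ^ (1 - β) :=
    ((tendsto_rpow_atTop (by linarith)).comp hcast).eventually_gt_atTop _
  have h2 : ∀ᶠ n : ℕ in atTop, (4 : ℝ) ≤ ((n + 1 : ℕ) : ℝ) ^ (β + ε - 1) :=
    ((tendsto_rpow_atTop (by linarith)).comp hcast).eventually_ge_atTop _
  have h3 : ∀ᶠ n : ℕ in atTop, (((n + 1 : ℕ) : ℝ) ^ β) ^ (p / β)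
      * Real.exp (-(1 / 2) * ((n + 1 : ℕ) : ℝ) ^ β) < 1 / (2 * Real.exp 1) :=
    ((tendsto_rpow_mul_exp_neg_mul_atTop_nhds_zero (p / β) (1 / 2) (by norm_num)).comp
      ((tendsto_rpow_atTop hβ).comp hcast)).eventually (gt_mem_nhds (by positivity))
  filter_upwards [h1, h2, h3, eventually_ge_atTop 1] with n h1 h2 h3 hn
  have hn1 : (1 : ℝ) ≤ n := by exact_mod_cast hn
  set N : ℝ := ((n + 1 : ℕ) : ℝ) with hN
  have hNn : N = n + 1 := by rw [hN]; push_cast; ring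
  have hN1 : 1 < N := by linarith
  have hN0 : 0 < N := by linarith
  have hy1 : 1 ≤ N ^ β := Real.one_le_rpow hN1.le hβ.le
  have hyN : N ^ β < N := by
    conv_rhs => rw [← Real.rpow_one N]
    exact Real.rpow_lt_rpow_of_exponent_lt hN1 hβ1
  have hkl : N ^ β - 1 < numNeighbours β (n + 1) := Nat.sub_one_lt_floor _
  have hku : (numNeighbours β (n + 1) : ℝ) ≤ N ^ β := Nat.floor_le (by positivity)
  have hmulβ : N * N ^ (β - 1) = N ^ β := by
    rw [← Real.rpow_one_add' hN0.le (by simpa using hβ.ne')]; congr 1; ring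
  refine ⟨Nat.one_le_floor_iff _ |>.2 hy1, ?_, Real.rpow_lt_one_of_one_lt_of_neg hN1 (by linarith),
    ?_, ?_⟩
  · exact Nat.lt_succ_iff.1 ((Nat.floor_lt (by positivity)).2 hyN)
  · have e : N ^ (β - 1) = (N ^ (1 - β))⁻¹ := by rw [← Real.rpow_neg hN0.le]; congr 1; ring
    rw [e, ← div_eq_mul_inv]
    exact (div_lt_one (by positivity)).2 h1
  · have t1 : Real.exp (2 * (n * N ^ (-ε)) - numNeighbours β (n + 1))
        ≤ Real.exp (1 + -(1 / 2) * N ^ β) := by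
      rw [Real.exp_le_exp]
      have e : N * N ^ (-ε) * N ^ (β + ε - 1) = N ^ β := by
        rw [mul_assoc, ← Real.rpow_add hN0, ← hmulβ]
        congr 2
        ring
      have e' : 4 * (N * N ^ (-ε)) ≤ N ^ β := by
        rw [← e, mul_comm]
        gcongr
      have e'' : (n : ℝ) * N ^ (-ε) ≤ N * N ^ (-ε) := by
        gcongr
        linarith
      linarith
    have t2 : Real.exp (numNeighbours β (n + 1) - n * (8 * N ^ (β - 1)) / 2)
        ≤ Real.exp (1 + -(1 / 2) * N ^ β) := by
      rw [Real.exp_le_exp]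
      have hpos : 0 < N ^ (β - 1) := Real.rpow_pos_of_pos hN0 _
      have : N ^ β ≤ 2 * (n * N ^ (β - 1)) := by
        rw [← hmulβ, ← mul_assoc]
        gcongr
        linarith
      linarith
    have hpow : (N ^ β) ^ (p / β) = N ^ p := by
      rw [← Real.rpow_mul hN0.le, mul_div_cancel₀ _ hβ.ne']
    rw [hpow, lt_div_iff₀ (by positivity)] at h3
    rw [Real.rpow_neg hN0.le p, ← one_div, le_div_iff₀ (Real.rpow_pos_of_pos hN0 _)]
    calc _ ≤ (Real.exp (1 + -(1 / 2) * N ^ β) + Real.exp (1 + -(1 / 2) * N ^ β)) * N ^ p := by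
          gcongr
      _ = N ^ p * Real.exp (-(1 / 2) * N ^ β) * (2 * Real.exp 1) := by rw [Real.exp_add]; ring
      _ ≤ 1 := h3.le

/-- The mean square error for all admissible parameters. -/
theorem Admissible.mseRate {d m : ℕ} (hd : 1 ≤ d)
    {μ : Measure (Euc d)} [IsProbabilityMeasure μ] {ν : Measure (Euc m)} [IsProbabilityMeasure ν]
    {g : Euc d → Euc m → ℝ} (hg : Measurable (fun p : Euc d × Euc m => g p.1 p.2))
    (hA1 : LipschitzConditionalLaws μ ν g) (hA2 : HasDensityBoundedBelow μ)
    (hA3 : BoundedCode g) (hA4 : OutputDensities μ ν g)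
    {α : ℝ} (hα : 0 < α) (hα1 : α < 1) {x : Euc d} (hx : x ∈ μ.support)
    (hfat : SupportFatAt μ x) {γ β ε : ℝ} (hadm : Admissible d γ β ε) (R : ℝ) :
    MSERate.{u} μ ν g α x R γ β (rateExponent d γ β ε) := by
  have hr0 := hadm.rateExponent_pos
  obtain ⟨hr1, hr2⟩ := rateExponent_le (γ := γ) (β := β) (ε := ε) hd
  set r := rateExponent d γ β ε with hr
  obtain ⟨hγ, hγβ, hβ1, hε, hεγ, -, -⟩ := hadm
  have hβ : 0 < β := hγ.trans_le hγβ
  have hd1 : (1 : ℝ) ≤ d := by exact_mod_cast hd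
  obtain ⟨L, U, hLU⟩ := hA3
  have hgx : Measurable (g x) := hg.comp (measurable_const.prodMk measurable_id)
  have hprob : IsProbabilityMeasure (outputLaw ν g x) :=
    Measure.isProbabilityMeasure_map hgx.aemeasurable
  obtain ⟨hdens, hconn⟩ := hA4 x hx
  have : NullSingletonClass (outputLaw ν g x) :=
    ⟨fun t => hdens.absolutelyContinuous (measure_singleton t)⟩
  have hq := quantile_mem_Icc (outputLaw ν g x) hα hα1 (L := L) (U := U)
    ((ae_map_iff hgx.aemeasurable measurableSet_Icc).2 (Eventually.of_forall fun e => hLU x e))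
  set A := max |R| (max |L| |U|) with hA
  have hA0 : 0 ≤ A := (abs_nonneg _).trans (le_max_left _ _)
  have hIcc : ∀ y ∈ Set.Icc L U, |y| ≤ A := fun y hy =>
    (abs_le_max_abs_abs hy.1 hy.2).trans (le_max_right _ _)
  obtain ⟨C, hC, hlip⟩ := exists_cdf_sub_le_rpow hd hA1 hA2 hx hfat
  obtain ⟨c₀, hc₀, hquad₀⟩ := exists_quadratic_lower_bound hdens hconn hα hα1 (2 * A + 1)
  -- The cap 1/2 keeps the contraction factor nonnegative.
  set c := min c₀ (1 / 2) with hc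
  have hc0 : 0 < c := lt_min hc₀ (by norm_num)
  have hc1 : 2 * c ≤ 1 := by linarith [min_le_right c₀ (1 / 2)]
  obtain ⟨N₀, hN₀⟩ := eventually_atTop.1 (eventually_exp_tail_le hβ hβ1 hε (γ + ε + r))
  -- One term each for the bias, the variance and the bad events; the tail exponent γ + ε + r above
  -- makes the last one match the others.
  set D := 2 * (2 * A + 1) * C * 8 ^ (1 + 1 / (d : ℝ)) + 8 + (2 * A + 1) ^ 2 with hD
  have hD0 : 0 ≤ D := by positivity
  obtain ⟨C', hC', N, hN⟩ := exists_rate_of_contraction (a := γ + ε) (r := r) (c := 2 * c) (D := D)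
    (A := (2 * A + 1) ^ 2) (by linarith) (by linarith) hr0.le (by linarith) hD0 N₀
  refine ⟨C', hC', N, ?_⟩
  intro Ω _ P _ X seed hsample θ₀ hθ₀ n hn
  have hθA : |θ₀| ≤ A := hθ₀.trans ((le_abs_self R).trans (le_max_left _ _))
  have hgA : ∀ z e, |g z e| ≤ A := fun z e => hIcc _ (hLU z e)
  set Q := Measure.infinitePi fun _ : ℕ => μ.prod ν with hQ
  have hbd := fun n w => (seqSqError_le (β := β) (w := w) hα.le hα1.le hγ.le hθA hgA
    (hIcc _ hq) n).2
  have hmeas := measurable_seqSqError ν hg α γ β θ₀ x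
  have hint : ∀ n, Integrable (seqSqError ν g α γ β θ₀ x n) Q := fun n =>
    Integrable.of_bound (hmeas n).aestronglyMeasurable _ (Eventually.of_forall (hbd n))
  -- The error depends on the sample only through its law, a product measure; this frees the
  -- constants from the probability space.
  have hlaw : HasLaw (fun ω i => (X i ω, seed i ω)) Q P :=
    hsample.2.hasLaw_infinitePi hsample.1
      (aemeasurable_pi_iff.2 fun i => (hsample.1 i).aemeasurable)
  have hrate := hN (fun n => ∫ w, seqSqError ν g α γ β θ₀ x n w ∂Q)
    (fun n => integral_nonneg fun w => sq_nonneg _)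
    (fun n => by
      refine (integral_mono (hint n) (integrable_const ((2 * A + 1) ^ 2))
        fun w => (le_abs_self _).trans (hbd n w)).trans ?_
      simp) ?_ n hn
  · have hmap := hlaw.map_eq
    constructor
    · have h := hint n
      rw [← hmap] at h
      exact h.comp_aemeasurable hlaw.aemeasurable
    · refine le_trans (le_of_eq ?_) hrate
      rw [← hmap, integral_map hlaw.aemeasurable (hmeas n).aestronglyMeasurable]
      rfl
  · intro n hn
    obtain ⟨g1, g2, g3, g4, g5⟩ := hN₀ n hn
    have hN0 : (0 : ℝ) < ((n + 1 : ℕ) : ℝ) := by positivity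
    have hN1 : (1 : ℝ) ≤ ((n + 1 : ℕ) : ℝ) := by push_cast; linarith [n.cast_nonneg (α := ℝ)]
    have hrec := integral_seqSqError_succ_le hd hA2.absolutelyContinuous hg hα.le hα1.le hγ.le hθA
      hgA (hIcc _ hq) hC hlip hc0.le hc1
      (fun t ht => (mul_le_mul_of_nonneg_right (min_le_left _ _) (sq_nonneg _)).trans
        (hquad₀ t ht)) g1 g2 (Real.rpow_pos_of_pos hN0 (-ε)) g3 (by positivity) g4
    refine hrec.trans ?_
    set z : ℝ := ((n + 1 : ℕ) : ℝ) with hz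
    have e1 : 2 * c * z ^ (-γ) * z ^ (-ε) = 2 * c * z ^ (-(γ + ε)) := by
      rw [mul_assoc, ← Real.rpow_add hN0]; congr 2; ring
    have e2 : z ^ (-γ) * (8 * z ^ (β - 1)) ^ (1 + 1 / (d : ℝ))
        ≤ 8 ^ (1 + 1 / (d : ℝ)) * z ^ (-(γ + ε + r)) := by
      rw [Real.mul_rpow (by norm_num) (by positivity), ← Real.rpow_mul hN0.le, mul_left_comm,
        ← Real.rpow_add hN0]
      gcongr
      linarith
    have e3 : (z ^ (-γ)) ^ 2 * (8 * z ^ (β - 1)) ≤ 8 * z ^ (-(γ + ε + r)) := by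
      rw [mul_left_comm, ← Real.rpow_mul_natCast hN0.le, ← Real.rpow_add hN0]
      gcongr
      push_cast
      linarith
    rw [e1]
    have hK : 0 ≤ 2 * (2 * A + 1) * C := by positivity
    have e4 := mul_le_mul_of_nonneg_left e2 hK
    have e5 := mul_le_mul_of_nonneg_left g5 (sq_nonneg (2 * A + 1))
    rw [hD]
    linarith

theorem MSERate.mono {d m : ℕ} {μ : Measure (Euc d)} {ν : Measure (Euc m)}
    {g : Euc d → Euc m → ℝ} {α : ℝ} {x : Euc d} {R γ β r r' : ℝ}
    (h : MSERate.{u} μ ν g α x R γ β r) (hr : r' ≤ r) : MSERate.{u} μ ν g α x R γ β r' := by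
  obtain ⟨C, hC, N, hN⟩ := h
  -- Comparing powers with different exponents requires a base at least 1.
  refine ⟨C, hC, max N 1, fun Ω _ P _ X seed hs θ₀ hθ n hn => ?_⟩
  obtain ⟨h1, h2⟩ := hN Ω P X seed hs θ₀ hθ n ((le_max_left _ _).trans hn)
  have hn1 : (1 : ℝ) ≤ n := by exact_mod_cast (le_max_right _ _).trans hn
  refine ⟨h1, h2.trans ?_⟩
  gcongr

theorem corollary2 {d m : ℕ} (hd : 1 ≤ d)
    (μ : Measure (Euc d)) [IsProbabilityMeasure μ]
    (ν : Measure (Euc m)) [IsProbabilityMeasure ν]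
    (g : Euc d → Euc m → ℝ) (hg : Measurable (fun p : Euc d × Euc m => g p.1 p.2))
    (hA1 : LipschitzConditionalLaws μ ν g)
    (hA2 : HasDensityBoundedBelow μ)
    (hA3 : BoundedCode g)
    (hA4 : OutputDensities μ ν g)
    (α : ℝ) (hα : 1 / 2 ≤ α) (hα1 : α < 1)
    (x : Euc d) (hx : x ∈ μ.support) (hfat : SupportFatAt μ x) :
    -- the upper bound, for all admissible parameters
    (∀ γ β ε : ℝ, Admissible d γ β ε →
      ∀ R : ℝ, MSERate.{u} μ ν g α x R γ β (rateExponent d γ β ε)) ∧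
    -- its exponent is always below `1/(1+d)`, which is the supremum
    (∀ γ β ε : ℝ, Admissible d γ β ε → rateExponent d γ β ε < 1 / (1 + (d : ℝ))) ∧
    IsLUB {r : ℝ | ∃ γ β ε : ℝ, Admissible d γ β ε ∧ r = rateExponent d γ β ε}
      (1 / (1 + (d : ℝ))) ∧
    -- the supremum is approached by `γ = 1/(1+d)`, `β = γ + η_β` as `η_β` decreases to `0` ...
    (∀ ηβ : ℝ, 0 < ηβ → 1 / (1 + (d : ℝ)) + ηβ < 1 →
      IsLUB {r : ℝ | ∃ ε : ℝ, Admissible d (1 / (1 + (d : ℝ))) (1 / (1 + (d : ℝ)) + ηβ) ε ∧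
        r = rateExponent d (1 / (1 + (d : ℝ))) (1 / (1 + (d : ℝ)) + ηβ) ε}
        (1 / (1 + (d : ℝ)) - ηβ / d)) ∧
    -- ... and only near these parameters
    (∀ γ β ε : ℕ → ℝ, (∀ j, Admissible d (γ j) (β j) (ε j)) →
      Tendsto (fun j => rateExponent d (γ j) (β j) (ε j)) atTop (𝓝 (1 / (1 + (d : ℝ)))) →
      Tendsto γ atTop (𝓝 (1 / (1 + (d : ℝ)))) ∧ Tendsto β atTop (𝓝 (1 / (1 + (d : ℝ))))) ∧
    -- the rate for these parameters, with `η = η_ε / 2 + η_β` and `η_ε = ε - (1 - β)`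
    (∀ γ β ηβ ε ηε η : ℝ, γ = 1 / (1 + (d : ℝ)) → 0 < ηβ → β = γ + ηβ → β < 1 →
      1 - β < ε → ε < 1 → ηε = ε - (1 - β) → η = ηε / 2 + ηβ →
      ∀ R : ℝ, MSERate.{u} μ ν g α x R γ β (1 / (1 + (d : ℝ)) - η)) := by
  have hα0 : 0 < α := by linarith
  refine ⟨fun γ β ε h R => h.mseRate hd hg hA1 hA2 hA3 hA4 hα0 hα1 hx hfat R,
    fun γ β ε h => h.rateExponent_lt_sup hd, isLUB_rateExponent hd,
    fun ηβ h0 h1 => isLUB_rateExponent_optimal hd h0 h1,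
    fun γ β ε hA hr => tendsto_of_rateExponent_tendsto hd hA hr, ?_⟩
  rintro γ β ηβ ε ηε η rfl h0 rfl hβ hε - rfl rfl R
  -- The bound is applied at 1 - β + δ with δ < η_ε/2, small enough for admissibility. Its exponent
  -- 1/(1+d) - η_β/d - δ is then at least 1/(1+d) - η.
  obtain ⟨δ, -, hδ', hadm⟩ := admissible_optimal hd h0 hβ (half_pos (sub_pos.2 hε))
  refine (hadm.mseRate hd hg hA1 hA2 hA3 hA4 hα0 hα1 hx hfat R).mono ?_
  rw [rateExponent_optimal h0 _ hd]
  have : ηβ / d ≤ ηβ := div_le_self h0.le (by exact_mod_cast hd)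
  linarith
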